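/- Let $\mathcal L^*=\{0,1,<,+,\nu\}$ be the first-order language (with equality) having constant symbols $0,1$, a binary relation symbol $<$, a binary function symbol $+$ and a unary function symbol $\nu$; terms and formulas are finite strings of symbols (the logical symbols $\neg,\wedge,\vee,\to,\leftrightarrow,\forall,\exists,=$, the symbols of $\mathcal L^*$ and variables), written in prefix notation, so that $\neg\sigma$ is the string $\sigma$ with the symbol $\neg$ put in front. A *theory* is a set of sentences; $\vdash$ is provability in classical first-order logic with equality. A *Gödel coding* is a computable injection from the finite strings of symbols into $\mathbb N$. For $n\in\mathbb N$, $\overline n$ is the closed term $0$, $1$, or $1+\cdots+1$ ($n$ times). Given a coding $\mathrm{code}$, write $\#\sigma$ for the closed term $\overline{\mathrm{code}(\sigma)}$, and let $Q^-$ be the theory with the axioms $(\mathsf A_1)$ $\forall x\,(x<\overline n\vee x=\overline n\vee\overline n<x)$ and $(\mathsf A_2)$ $\forall x\,(x<\overline n\leftrightarrow\bigvee_{i<n}x=\overline i)$ for every $n\in\mathbb N$, and $(\mathsf A_3)$ $\nu(\#\sigma)=\#(\neg\sigma)$ for every sentence $\sigma$. For a theory $T$ and a fixed coding consider the following statements.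 * $\mathrm{G\ddot odel}_T$: if $U$ is a consistent theory extending $T$ and $\Psi(x)$ is a formula with the only free variable $x$ such that for every sentence $\sigma$, $U\vdash\sigma$ iff $U\vdash\Psi(\#\sigma)$, then $U$ is incomplete. * $\mathrm{Tarski}_T$: for every formula $\Upsilon(x)$ with the only free variable $x$, $T$ is inconsistent with $\{\Upsilon(\#\sigma)\leftrightarrow\sigma \mid \sigma\text{ a sentence}\}$. * $\mathrm{Carnap}_T$: for every formula $\Lambda(x)$ with the only free variable $x$, there are finitely many sentences $A_i$ with $T\vdash\bigvee_i(\Lambda(\#A_i)\leftrightarrow A_i)$. * $\mathrm{Rosser}_T$: if $U$ is a consistent theory extending $T$ and $\Theta(x,y)$ is a formula with exactly the free variables $x,y$ such that for every sentence $\sigma$, (i) if $U\vdash\sigma$ then $U\vdash\Theta(\overline m,\#\sigma)$ for some $m\in\mathbb N$, and (ii) if $U\nvdash\sigma$ then $U\vdash\neg\Theta(\overline n,\#\sigma)$ for every $n\in\mathbb N$, then $U$ is incomplete. Let $\nu^*(n)=33+16n$ for even $n$ and $\nu^*(n)=16+16n$ for odd $n$, let $\mathfrak M^*$ be the structure $\langle\mathbb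 N;0,1,<,+,\nu\rangle$ with $\nu$ interpreted as $\nu^*$, and let $T^*=\mathrm{Th}(\mathfrak M^*)$ be the set of all sentences true in $\mathfrak M^*$. Let the symbols be coded by odd numbers through any computable injection with $\neg$ coded by $3$. Ackermann's coding gives the empty string the code $1$ and a nonempty string $\langle a_1,\dots,a_\ell\rangle$ of codes of symbols the code $\ulcorner\eta\urcorner=\sum_{k=1}^{\ell}2^{(a_1+1)+\cdots+(a_k+1)}$. The new coding assigns to a string $\eta$ the number $2\ulcorner\eta\urcorner$ if $\eta$ is a sentence true in $\mathfrak M^*$, and $1+2\ulcorner\eta\urcorner$ otherwise. Let $\Psi^*(x)=\Upsilon^*(x)=\exists z\,(x=z+z)$, $\Lambda^*(x)=\neg\Psi^*(x)$ and $\Theta^*(x,y)=\Psi^*(y)\wedge(x=x)$. **Theorem.** The new coding is a Gödel coding (computable and injective). With respect to it, $T^*$ is a complete and decidable theory that contains $Q^-$, and none of $\mathrm{G\ddot odel}_{T^*}$, $\mathrm{Tarski}_{T^*}$, $\mathrm{Carnap}_{T^*}$, $\mathrm{Rosser}_{T^*}$ holds: they fail, respectively, for $U=T^*$ and $\Psi^*(x)$,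 for $\Upsilon^*(x)$, for $\Lambda^*(x)$, and for $U=T^*$ and $\Theta^*(x,y)$. -/

import Mathlib

namespace LStar

/-- The symbols of the first-order language with non-logical symbols `0, 1, <, +, ν`.
Expressions are finite strings of symbols; terms and formulas are written in prefix
(Polish) notation, so no parentheses are needed. `var n` is the `n`-th variable. -/
inductive Symbol : Type
  | neg | and | or | imp | iff | all | ex | eq | lt | zero | one | plus | nu
  | var (n : ℕ)

namespace Symbol

def toNat : Symbol → ℕ
  | neg => 0 | and => 1 | or => 2 | imp => 3 | iff => 4 | all => 5 | ex => 6
  | eq => 7 | lt => 8 | zero => 9 | one => 10 | plus => 11 | nu => 12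
  | var n => n + 13

def ofNat : ℕ → Symbol
  | 0 => neg | 1 => and | 2 => or | 3 => imp | 4 => iff | 5 => all | 6 => ex
  | 7 => eq | 8 => lt | 9 => zero | 10 => one | 11 => plus | 12 => nu
  | n + 13 => var n

def equivNat : Symbol ≃ ℕ where
  toFun := toNat
  invFun := ofNat
  left_inv s := by cases s <;> rfl
  right_inv n := by
    match n with
    | 0 | 1 | 2 | 3 | 4 | 5 | 6 | 7 | 8 | 9 | 10 | 11 | 12 => rfl
    | _ + 13 => rfl

/-- The presentation of the symbols with respect to which computability is understood. -/
instance : Primcodable Symbol := Primcodable.ofEquiv ℕ equivNat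

end Symbol

/-! ### Terms and formulas -/

inductive Term : Type
  | var (n : ℕ)
  | zero
  | one
  | plus (s t : Term)
  | nu (t : Term)

inductive Formula : Type
  | eq (s t : Term)
  | lt (s t : Term)
  | neg (φ : Formula)
  | and (φ ψ : Formula)
  | or (φ ψ : Formula)
  | imp (φ ψ : Formula)
  | iff (φ ψ : Formula)
  | all (n : ℕ) (φ : Formula)
  | ex (n : ℕ) (φ : Formula)

namespace Term

/-- The string of symbols that the term is. -/
def str : Term → List Symbol
  | var n => [Symbol.var n]
  | zero => [Symbol.zero]
  | one => [Symbol.one]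
  | plus s t => Symbol.plus :: (s.str ++ t.str)
  | nu t => Symbol.nu :: t.str

/-- The variables of a term. -/
def vars : Term → Finset ℕ
  | var n => {n}
  | zero => ∅
  | one => ∅
  | plus s t => s.vars ∪ t.vars
  | nu t => t.vars

/-- `s.subst x t` is the term `s` with `t` in place of the variable `x`. -/
def subst (s : Term) (x : ℕ) (t : Term) : Term :=
  match s with
  | var n => if n = x then t else var n
  | zero => zero
  | one => one
  | plus r s => plus (r.subst x t) (s.subst x t)
  | nu s => nu (s.subst x t)

/-- The numeral of `n`: `0`, `1`, `1+1`, `(1+1)+1`, … -/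
def num : ℕ → Term
  | 0 => zero
  | 1 => one
  | n + 2 => plus (num (n + 1)) one

end Term

namespace Formula

/-- The string of symbols that the formula is; a negation is written with `¬` to the left. -/
def str : Formula → List Symbol
  | eq s t => Symbol.eq :: (s.str ++ t.str)
  | lt s t => Symbol.lt :: (s.str ++ t.str)
  | neg φ => Symbol.neg :: φ.str
  | and φ ψ => Symbol.and :: (φ.str ++ ψ.str)
  | or φ ψ => Symbol.or :: (φ.str ++ ψ.str)
  | imp φ ψ => Symbol.imp :: (φ.str ++ ψ.str)
  | iff φ ψ => Symbol.iff :: (φ.str ++ ψ.str)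
  | all n φ => Symbol.all :: Symbol.var n :: φ.str
  | ex n φ => Symbol.ex :: Symbol.var n :: φ.str

/-- The free variables of a formula. -/
def freeVars : Formula → Finset ℕ
  | eq s t => s.vars ∪ t.vars
  | lt s t => s.vars ∪ t.vars
  | neg φ => φ.freeVars
  | and φ ψ => φ.freeVars ∪ ψ.freeVars
  | or φ ψ => φ.freeVars ∪ ψ.freeVars
  | imp φ ψ => φ.freeVars ∪ ψ.freeVars
  | iff φ ψ => φ.freeVars ∪ ψ.freeVars
  | all n φ => φ.freeVars.erase n
  | ex n φ => φ.freeVars.erase n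

/-- A sentence is a formula without free variables. -/
def IsSentence (φ : Formula) : Prop := φ.freeVars = ∅

/-- `φ.subst x t`: replace the free occurrences of the variable `x` in `φ` by the term `t`. -/
def subst (φ : Formula) (x : ℕ) (t : Term) : Formula :=
  match φ with
  | eq r s => eq (r.subst x t) (s.subst x t)
  | lt r s => lt (r.subst x t) (s.subst x t)
  | neg φ => neg (φ.subst x t)
  | and φ ψ => and (φ.subst x t) (ψ.subst x t)
  | or φ ψ => or (φ.subst x t) (ψ.subst x t)
  | imp φ ψ => imp (φ.subst x t) (ψ.subst x t)
  | iff φ ψ => iff (φ.subst x t) (ψ.subst x t)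
  | all n φ => if n = x then all n φ else all n (φ.subst x t)
  | ex n φ => if n = x then ex n φ else ex n (φ.subst x t)

/-- The term `t` is free for the variable `x` in `φ`: no variable of `t` is captured
when `t` is substituted for the free occurrences of `x`. -/
def FreeFor (x : ℕ) (t : Term) : Formula → Prop
  | eq _ _ => True
  | lt _ _ => True
  | neg φ => FreeFor x t φ
  | and φ ψ => FreeFor x t φ ∧ FreeFor x t ψ
  | or φ ψ => FreeFor x t φ ∧ FreeFor x t ψ
  | imp φ ψ => FreeFor x t φ ∧ FreeFor x t ψ
  | iff φ ψ => FreeFor x t φ ∧ FreeFor x t ψ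
  | all n φ => x ∉ (all n φ).freeVars ∨ (n ∉ t.vars ∧ FreeFor x t φ)
  | ex n φ => x ∉ (ex n φ).freeVars ∨ (n ∉ t.vars ∧ FreeFor x t φ)

/-- Finite disjunctions; the empty disjunction is the false sentence `¬ 0 = 0`. -/
def disj : List Formula → Formula
  | [] => neg (eq Term.zero Term.zero)
  | [φ] => φ
  | φ :: ψ :: l => or φ (disj (ψ :: l))

end Formula

/-! ### Provability -/

/-- Natural deduction for classical first-order logic with equality, with finite lists of
formulas as contexts. -/
inductive Derives : List Formula → Formula → Prop
  | hyp {Γ φ} : φ ∈ Γ → Derives Γ φ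
  | weaken {Γ Δ φ} : Γ ⊆ Δ → Derives Γ φ → Derives Δ φ
  | negI {Γ φ ψ} : Derives (φ :: Γ) ψ → Derives (φ :: Γ) (.neg ψ) → Derives Γ (.neg φ)
  | raa {Γ φ ψ} : Derives (.neg φ :: Γ) ψ → Derives (.neg φ :: Γ) (.neg ψ) → Derives Γ φ
  | andI {Γ φ ψ} : Derives Γ φ → Derives Γ ψ → Derives Γ (.and φ ψ)
  | andE₁ {Γ φ ψ} : Derives Γ (.and φ ψ) → Derives Γ φ
  | andE₂ {Γ φ ψ} : Derives Γ (.and φ ψ) → Derives Γ ψ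
  | orI₁ {Γ φ ψ} : Derives Γ φ → Derives Γ (.or φ ψ)
  | orI₂ {Γ φ ψ} : Derives Γ ψ → Derives Γ (.or φ ψ)
  | orE {Γ φ ψ χ} : Derives Γ (.or φ ψ) → Derives (φ :: Γ) χ → Derives (ψ :: Γ) χ →
      Derives Γ χ
  | impI {Γ φ ψ} : Derives (φ :: Γ) ψ → Derives Γ (.imp φ ψ)
  | impE {Γ φ ψ} : Derives Γ (.imp φ ψ) → Derives Γ φ → Derives Γ ψ
  | iffI {Γ φ ψ} : Derives (φ :: Γ) ψ → Derives (ψ :: Γ) φ → Derives Γ (.iff φ ψ)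
  | iffE₁ {Γ φ ψ} : Derives Γ (.iff φ ψ) → Derives Γ φ → Derives Γ ψ
  | iffE₂ {Γ φ ψ} : Derives Γ (.iff φ ψ) → Derives Γ ψ → Derives Γ φ
  | allI {Γ} {φ : Formula} {x : ℕ} : (∀ γ ∈ Γ, x ∉ γ.freeVars) → Derives Γ φ → Derives Γ (.all x φ)
  | allE {Γ} {φ : Formula} {x : ℕ} {t : Term} : φ.FreeFor x t → Derives Γ (.all x φ) →
      Derives Γ (φ.subst x t)
  | exI {Γ} {φ : Formula} {x : ℕ} {t : Term} : φ.FreeFor x t → Derives Γ (φ.subst x t) →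
      Derives Γ (.ex x φ)
  | exE {Γ} {φ ψ : Formula} {x : ℕ} : (∀ γ ∈ Γ, x ∉ γ.freeVars) → x ∉ ψ.freeVars →
      Derives Γ (.ex x φ) → Derives (φ :: Γ) ψ → Derives Γ ψ
  | eqI {Γ} {t : Term} : Derives Γ (.eq t t)
  | eqE {Γ} {φ : Formula} {x : ℕ} {s t : Term} : φ.FreeFor x s → φ.FreeFor x t →
      Derives Γ (.eq s t) → Derives Γ (φ.subst x s) → Derives Γ (φ.subst x t)

/-- A theory is a set of sentences. -/
def IsTheory (T : Set Formula) : Prop := ∀ φ ∈ T, φ.IsSentence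

/-- `T ⊢ φ`. -/
def Provable (T : Set Formula) (φ : Formula) : Prop :=
  ∃ Γ : List Formula, (∀ γ ∈ Γ, γ ∈ T) ∧ Derives Γ φ

def Consistent (T : Set Formula) : Prop :=
  ¬ ∃ φ : Formula, Provable T φ ∧ Provable T (.neg φ)

def Complete (T : Set Formula) : Prop :=
  ∀ σ : Formula, σ.IsSentence → Provable T σ ∨ Provable T (.neg σ)

/-- `U` is an extension of `T`. -/
def Extends (U T : Set Formula) : Prop :=
  ∀ σ : Formula, σ.IsSentence → Provable T σ → Provable U σ

/-- The set of (strings that are) sentences provable in `T` is decidable. -/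
def DecidableTheory (T : Set Formula) : Prop :=
  ComputablePred fun η : List Symbol => ∃ σ : Formula, σ.IsSentence ∧ Provable T σ ∧ σ.str = η

/-! ### Codings and the theory `Q⁻` -/

/-- A Gödel coding is a computable injection from the strings into the natural numbers. -/
def IsGodelCoding (code : List Symbol → ℕ) : Prop :=
  Computable code ∧ Function.Injective code

/-- The closed term denoting the code of the formula `φ`. -/
def quote (code : List Symbol → ℕ) (φ : Formula) : Term := Term.num (code φ.str)

/-- The axioms of `Q⁻` relative to a coding. -/
inductive QMinus (code : List Symbol → ℕ) : Set Formula
  | A₁ (n : ℕ) : QMinus code (.all 0 (.or (.lt (.var 0) (Term.num n))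
      (.or (.eq (.var 0) (Term.num n)) (.lt (Term.num n) (.var 0)))))
  | A₂ (n : ℕ) : QMinus code (.all 0 (.iff (.lt (.var 0) (Term.num n))
      (Formula.disj ((List.range n).map fun i => .eq (.var 0) (Term.num i)))))
  | A₃ (σ : Formula) : σ.IsSentence →
      QMinus code (.eq (.nu (quote code σ)) (quote code (.neg σ)))

/-! ### The four statements

Each is stated first for given `U` and a given formula, then in general. -/

section
variable (code : List Symbol → ℕ)

/-- The Gödel statement of `T` for `U` and `Ψ(x)`. -/
def GodelFor (T U : Set Formula) (x : ℕ) (Ψ : Formula) : Prop :=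
  IsTheory U → Extends U T → Consistent U → Ψ.freeVars = {x} →
  (∀ σ : Formula, σ.IsSentence → (Provable U σ ↔ Provable U (Ψ.subst x (quote code σ)))) →
  ¬ Complete U

def Godel (T : Set Formula) : Prop :=
  ∀ (U : Set Formula) (x : ℕ) (Ψ : Formula), GodelFor code T U x Ψ

/-- The Tarski statement of `T` for `Υ(x)`. -/
def TarskiFor (T : Set Formula) (x : ℕ) (Υ : Formula) : Prop :=
  Υ.freeVars = {x} →
  ¬ Consistent (T ∪ {φ | ∃ σ : Formula, σ.IsSentence ∧ φ = .iff (Υ.subst x (quote code σ)) σ})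

def Tarski (T : Set Formula) : Prop :=
  ∀ (x : ℕ) (Υ : Formula), TarskiFor code T x Υ

/-- The Carnap statement of `T` for `Λ(x)`. -/
def CarnapFor (T : Set Formula) (x : ℕ) (Λ : Formula) : Prop :=
  Λ.freeVars = {x} →
  ∃ A : List Formula, (∀ σ ∈ A, σ.IsSentence) ∧
    Provable T (Formula.disj (A.map fun σ => .iff (Λ.subst x (quote code σ)) σ))

def Carnap (T : Set Formula) : Prop :=
  ∀ (x : ℕ) (Λ : Formula), CarnapFor code T x Λ

/-- The Rosser statement of `T` for `U` and `Θ(x,y)`. -/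
def RosserFor (T U : Set Formula) (x y : ℕ) (Θ : Formula) : Prop :=
  IsTheory U → Extends U T → Consistent U → x ≠ y → Θ.freeVars = {x, y} →
  (∀ σ : Formula, σ.IsSentence →
    (Provable U σ →
      ∃ m : ℕ, Provable U ((Θ.subst x (Term.num m)).subst y (quote code σ))) ∧
    (¬ Provable U σ →
      ∀ n : ℕ, Provable U (.neg ((Θ.subst x (Term.num n)).subst y (quote code σ))))) →
  ¬ Complete U

def Rosser (T : Set Formula) : Prop :=
  ∀ (U : Set Formula) (x y : ℕ) (Θ : Formula), RosserFor code T U x y Θ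

end

/-! ### The structure `M*`, its theory, and the new coding -/

def nuStar (n : ℕ) : ℕ := if Even n then 33 + 16 * n else 16 + 16 * n

/-- The value of a term in `M*` under an assignment of numbers to the variables. -/
def Term.eval (e : ℕ → ℕ) : Term → ℕ
  | .var n => e n
  | .zero => 0
  | .one => 1
  | .plus s t => s.eval e + t.eval e
  | .nu t => nuStar (t.eval e)

/-- Satisfaction of a formula in `M*` under an assignment. -/
def Formula.Sat : (ℕ → ℕ) → Formula → Prop
  | e, .eq s t => s.eval e = t.eval e
  | e, .lt s t => s.eval e < t.eval e
  | e, .neg φ => ¬ φ.Sat e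
  | e, .and φ ψ => φ.Sat e ∧ ψ.Sat e
  | e, .or φ ψ => φ.Sat e ∨ ψ.Sat e
  | e, .imp φ ψ => φ.Sat e → ψ.Sat e
  | e, .iff φ ψ => φ.Sat e ↔ ψ.Sat e
  | e, .all n φ => ∀ a : ℕ, φ.Sat (Function.update e n a)
  | e, .ex n φ => ∃ a : ℕ, φ.Sat (Function.update e n a)

/-- The complete theory of `M*`: the set of the sentences true in `M*`. -/
def TStar : Set Formula := {σ | σ.IsSentence ∧ ∀ e : ℕ → ℕ, σ.Sat e}

/-- Ackermann's coding of strings, given the codes of the symbols: the empty string has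
code `1`, and `⟨a₁, …, aₗ⟩` has code `∑ₖ 2 ^ ((a₁ + 1) + ⋯ + (aₖ + 1))`. -/
def ackermann (symCode : Symbol → ℕ) (η : List Symbol) : ℕ :=
  match η with
  | [] => 1
  | _ :: _ => ∑ k ∈ Finset.range η.length,
      2 ^ (((η.take (k + 1)).map fun s => symCode s + 1).sum)

open Classical in
/-- The new coding: twice Ackermann's code for the sentences true in `M*`, one more than
twice Ackermann's code for all other strings. -/
noncomputable def newCode (symCode : Symbol → ℕ) (η : List Symbol) : ℕ :=
  if ∃ σ ∈ TStar, σ.str = η then 2 * ackermann symCode η else 1 + 2 * ackermann symCode η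

/-- The formula `∃ z (v = z + z)` in the variable `v`; `z` is the variable with index `2`. -/
def evenFormula (v : ℕ) : Formula := .ex 2 (.eq (.var v) (.plus (.var 2) (.var 2)))

/-- `Ψ*(x)`; `x` is the variable with index `0`. -/
def PsiStar : Formula := evenFormula 0

def UpsilonStar : Formula := PsiStar

def LambdaStar : Formula := .neg PsiStar

/-- `Θ*(x,y) = Ψ*(y) ∧ x = x`; `x`, `y` are the variables with indices `0`, `1`. -/
def ThetaStar : Formula := .and (evenFormula 1) (.eq (.var 0) (.var 0))

end LStar

/-!
The new coding codes a sentence by an even number exactly if it is true in `M*`, so over `T*` the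
formula "`x` is even" is at once a provability predicate and a truth predicate, and its negation
has no fixed point. This refutes the four statements, by soundness of the calculus for `M*`.
The axioms `ν(#σ) = #(¬σ)` hold because prefixing `¬` sends Ackermann's code `a` to `16 + 16 a`,
while exactly one of `σ` and `¬σ` is true, so that the parity of the new code flips; `ν*` is
defined to do just this (`nuStar_newCode`). Injectivity follows from that of Ackermann's coding,
where the `2`-adic valuation of a code reveals the first symbol.

What takes work is that the new coding is computable, that is, that truth in `M*` is decidable.
Since `ν*` is linear on each parity class, this is Presburger arithmetic in disguise. The decision
procedure evaluates formulas recursively, searching for witnesses of quantifiers only up to an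
explicit bound, and does not transform formulas. That the bound is sufficient is shown by a back
and forth argument. Two assignments are `Similar` at level `N` if they agree modulo `N!` and on
the signs of all linear forms with coefficients up to `N`. If they are similar at a sufficiently
high level, then every value given to a variable in one of them can be matched, up to similarity at
level `N`, by a value in the other that exceeds some linear form by at most a bounded amount
(`Similar.exists_update`). So formulas do not distinguish assignments that are similar at the
level of the formula (`Formula.sat_iff_of_similar`), and taking the two assignments to be the same
one bounds the search (`Formula.exists_sat_update_iff`).

To see that the procedure is computable in the sense of Mathlib, formulas are compiled into codes
of partial recursive functions acting on assignments (`Formula.code`). Parsing a string from right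
to left with a stack compiles it at the same time: the stack of codes is a primitive recursive
function of the string (`primrec_items`), and evaluating the resulting code with the universal
partial recursive function gives the truth value.
-/

/-! ### Semantics of `M*` and soundness -/

namespace LStar

open Function

namespace Term

theorem eval_congr {t : Term} {e e' : ℕ → ℕ} (h : ∀ v ∈ t.vars, e v = e' v) :
    t.eval e = t.eval e' := by
  induction t with
  | var n => exact h n (by simp [vars])
  | zero | one => rfl
  | plus s t hs ht =>
    simp only [vars, Finset.mem_union] at h
    simp only [eval, hs fun v hv => h v (.inl hv), ht fun v hv => h v (.inr hv)]
  | nu t ht => simp only [eval, ht h]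

theorem eval_update_of_notMem {t : Term} {e : ℕ → ℕ} {n a : ℕ} (h : n ∉ t.vars) :
    t.eval (update e n a) = t.eval e :=
  eval_congr fun v hv => update_of_ne (by rintro rfl; exact h hv) _ _

theorem eval_subst (s : Term) (x : ℕ) (t : Term) (e : ℕ → ℕ) :
    (s.subst x t).eval e = s.eval (update e x (t.eval e)) := by
  induction s with
  | var n => by_cases h : n = x <;> simp [subst, eval, h]
  | zero | one => rfl
  | plus r s hr hs => simp only [subst, eval, hr, hs]
  | nu s hs => simp only [subst, eval, hs]

theorem subst_of_notMem {s : Term} {x : ℕ} {t : Term} (h : x ∉ s.vars) : s.subst x t = s := by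
  induction s with
  | var n =>
    have : n ≠ x := by rintro rfl; exact h (by simp [vars])
    simp [subst, this]
  | zero | one => rfl
  | plus r s hr hs =>
    simp only [vars, Finset.mem_union, not_or] at h
    simp only [subst, hr h.1, hs h.2]
  | nu s hs => simp only [subst, hs h]

@[simp] theorem vars_num : ∀ n : ℕ, (num n).vars = ∅
  | 0 | 1 => rfl
  | n + 2 => by simp [num, vars, vars_num (n + 1)]

@[simp] theorem eval_num (e : ℕ → ℕ) : ∀ n : ℕ, (num n).eval e = n
  | 0 | 1 => rfl
  | n + 2 => by simp [num, eval, eval_num e (n + 1)]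

end Term

namespace Formula

theorem sat_congr {φ : Formula} {e e' : ℕ → ℕ} (h : ∀ v ∈ φ.freeVars, e v = e' v) :
    φ.Sat e ↔ φ.Sat e' := by
  have upd : ∀ {ψ : Formula} {e e' : ℕ → ℕ} {n : ℕ}, (∀ v ∈ ψ.freeVars.erase n, e v = e' v) →
      ∀ a, ∀ v ∈ ψ.freeVars, update e n a v = update e' n a v := by
    intro ψ e e' n h a v hv
    by_cases hn : v = n
    · simp [hn]
    · simpa [hn] using h v (by simp [hn, hv])
  induction φ generalizing e e' with
  | eq s t | lt s t =>
    simp only [freeVars, Finset.mem_union] at h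
    simp only [Sat, Term.eval_congr fun v hv => h v (.inl hv),
      Term.eval_congr fun v hv => h v (.inr hv)]
  | neg φ ih => simp only [Sat, ih h]
  | and φ ψ h₁ h₂ | or φ ψ h₁ h₂ | imp φ ψ h₁ h₂ | iff φ ψ h₁ h₂ =>
    simp only [freeVars, Finset.mem_union] at h
    simp only [Sat, h₁ fun v hv => h v (.inl hv), h₂ fun v hv => h v (.inr hv)]
  | all n φ ih => exact forall_congr' fun a => ih (upd h a)
  | ex n φ ih => exact exists_congr fun a => ih (upd h a)

theorem sat_update_of_notMem {φ : Formula} {e : ℕ → ℕ} {n a : ℕ} (h : n ∉ φ.freeVars) :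
    φ.Sat (update e n a) ↔ φ.Sat e :=
  sat_congr fun v hv => update_of_ne (by rintro rfl; exact h hv) _ _

theorem IsSentence.sat_iff {σ : Formula} (h : σ.IsSentence) (e e' : ℕ → ℕ) :
    σ.Sat e ↔ σ.Sat e' :=
  sat_congr fun v hv => by rw [h] at hv; simp at hv

theorem subst_of_notMem {φ : Formula} {x : ℕ} {t : Term} (h : x ∉ φ.freeVars) :
    φ.subst x t = φ := by
  induction φ with
  | eq r s | lt r s =>
    simp only [freeVars, Finset.mem_union, not_or] at h
    simp only [subst, Term.subst_of_notMem h.1, Term.subst_of_notMem h.2]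
  | neg φ ih => simp only [subst, ih h]
  | and φ ψ h₁ h₂ | or φ ψ h₁ h₂ | imp φ ψ h₁ h₂ | iff φ ψ h₁ h₂ =>
    simp only [freeVars, Finset.mem_union, not_or] at h
    simp only [subst, h₁ h.1, h₂ h.2]
  | all n φ ih | ex n φ ih =>
    by_cases hn : n = x
    · simp [subst, hn]
    · have : x ∉ φ.freeVars := fun hx => h (by simp [freeVars, Ne.symm hn, hx])
      simp [subst, ih this]

theorem sat_subst {φ : Formula} {x : ℕ} {t : Term} (h : φ.FreeFor x t) (e : ℕ → ℕ) :
    (φ.subst x t).Sat e ↔ φ.Sat (update e x (t.eval e)) := by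
  induction φ generalizing e with
  | eq r s | lt r s => simp only [subst, Sat, Term.eval_subst]
  | neg φ ih => simp only [subst, Sat, ih h]
  | and φ ψ h₁ h₂ | or φ ψ h₁ h₂ | imp φ ψ h₁ h₂ | iff φ ψ h₁ h₂ =>
    simp only [subst, Sat, h₁ h.1, h₂ h.2]
  | all n φ ih | ex n φ ih =>
    by_cases hn : n = x
    · simp [subst, Sat, hn]
    · rcases h with h | ⟨hnt, hφ⟩
      · rw [subst_of_notMem h, sat_update_of_notMem h]
      · simp only [subst, hn, if_false, Sat, ih hφ, Term.eval_update_of_notMem hnt,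
          update_comm hn]

theorem freeFor_of_vars_eq_empty {t : Term} (ht : t.vars = ∅) (x : ℕ) (φ : Formula) :
    φ.FreeFor x t := by
  induction φ with
  | eq | lt => trivial
  | neg φ ih => exact ih
  | and φ ψ h₁ h₂ | or φ ψ h₁ h₂ | imp φ ψ h₁ h₂ | iff φ ψ h₁ h₂ => exact ⟨h₁, h₂⟩
  | all n φ ih | ex n φ ih => exact .inr ⟨by simp [ht], ih⟩

theorem sat_disj (e : ℕ → ℕ) : ∀ l : List Formula, (disj l).Sat e ↔ ∃ φ ∈ l, φ.Sat e
  | [] => by simp [disj, Sat]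
  | [φ] => by simp [disj]
  | φ :: ψ :: l => by rw [disj, Sat, sat_disj e (ψ :: l)]; simp

theorem freeVars_disj : ∀ l : List Formula, ∀ v ∈ (disj l).freeVars, ∃ φ ∈ l, v ∈ φ.freeVars
  | [], v, hv => by simp [disj, freeVars, Term.vars] at hv
  | [φ], v, hv => ⟨φ, by simp, hv⟩
  | φ :: ψ :: l, v, hv => by
    rw [disj, freeVars, Finset.mem_union] at hv
    rcases hv with hv | hv
    · exact ⟨φ, by simp, hv⟩
    · obtain ⟨χ, hχ, h⟩ := freeVars_disj (ψ :: l) v hv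
      exact ⟨χ, List.mem_cons_of_mem _ hχ, h⟩

end Formula

theorem Derives.sound {Γ : List Formula} {φ : Formula} (h : Derives Γ φ) (e : ℕ → ℕ)
    (hΓ : ∀ γ ∈ Γ, γ.Sat e) : φ.Sat e := by
  induction h generalizing e with
  | hyp h => exact hΓ _ h
  | weaken hs _ ih => exact ih e fun γ hγ => hΓ γ (hs hγ)
  | negI _ _ ih₁ ih₂ =>
    intro hφ
    have := List.forall_mem_cons.2 ⟨hφ, hΓ⟩
    exact ih₂ e this (ih₁ e this)
  | @raa Γ φ _ _ _ ih₁ ih₂ =>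
    by_contra hφ
    have : ∀ γ ∈ φ.neg :: Γ, γ.Sat e := List.forall_mem_cons.2 ⟨hφ, hΓ⟩
    exact ih₂ e this (ih₁ e this)
  | andI _ _ ih₁ ih₂ => exact ⟨ih₁ e hΓ, ih₂ e hΓ⟩
  | andE₁ _ ih => exact (ih e hΓ).1
  | andE₂ _ ih => exact (ih e hΓ).2
  | orI₁ _ ih => exact .inl (ih e hΓ)
  | orI₂ _ ih => exact .inr (ih e hΓ)
  | orE _ _ _ ih ih₁ ih₂ =>
    rcases ih e hΓ with h | h
    · exact ih₁ e (List.forall_mem_cons.2 ⟨h, hΓ⟩)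
    · exact ih₂ e (List.forall_mem_cons.2 ⟨h, hΓ⟩)
  | impI _ ih => exact fun h => ih e (List.forall_mem_cons.2 ⟨h, hΓ⟩)
  | impE _ _ ih₁ ih₂ => exact ih₁ e hΓ (ih₂ e hΓ)
  | iffI _ _ ih₁ ih₂ =>
    exact ⟨fun h => ih₁ e (List.forall_mem_cons.2 ⟨h, hΓ⟩),
      fun h => ih₂ e (List.forall_mem_cons.2 ⟨h, hΓ⟩)⟩
  | iffE₁ _ _ ih₁ ih₂ => exact (ih₁ e hΓ).1 (ih₂ e hΓ)
  | iffE₂ _ _ ih₁ ih₂ => exact (ih₁ e hΓ).2 (ih₂ e hΓ)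
  | allI hx _ ih =>
    exact fun a => ih _ fun γ hγ => (Formula.sat_update_of_notMem (hx γ hγ)).2 (hΓ γ hγ)
  | allE hf _ ih => exact (Formula.sat_subst hf e).2 (ih e hΓ _)
  | exI hf _ ih => exact ⟨_, (Formula.sat_subst hf e).1 (ih e hΓ)⟩
  | exE hx hψ _ _ ih₁ ih₂ =>
    obtain ⟨a, ha⟩ := ih₁ e hΓ
    refine (Formula.sat_update_of_notMem hψ).1 (ih₂ _ (List.forall_mem_cons.2 ⟨ha, ?_⟩))
    exact fun γ hγ => (Formula.sat_update_of_notMem (hx γ hγ)).2 (hΓ γ hγ)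
  | eqI => rfl
  | eqE hs ht _ _ ih₁ ih₂ =>
    rw [Formula.sat_subst ht, ← show Term.eval e _ = Term.eval e _ from ih₁ e hΓ]
    exact (Formula.sat_subst hs e).1 (ih₂ e hΓ)

theorem Provable.sat {T : Set Formula} {φ : Formula} (h : Provable T φ) (e : ℕ → ℕ)
    (hT : ∀ γ ∈ T, γ.Sat e) : φ.Sat e := by
  obtain ⟨Γ, hΓ, h⟩ := h
  exact h.sound e fun γ hγ => hT γ (hΓ γ hγ)

theorem consistent_of_sat {T : Set Formula} (e : ℕ → ℕ) (hT : ∀ γ ∈ T, γ.Sat e) :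
    Consistent T :=
  fun ⟨_, h₁, h₂⟩ => h₂.sat e hT (h₁.sat e hT)

theorem provable_of_mem {T : Set Formula} {φ : Formula} (h : φ ∈ T) : Provable T φ :=
  ⟨[φ], by simpa using h, .hyp (by simp)⟩

theorem mem_TStar_iff {σ : Formula} (h : σ.IsSentence) (e : ℕ → ℕ) : σ ∈ TStar ↔ σ.Sat e :=
  ⟨fun hσ => hσ.2 e, fun he => ⟨h, fun e' => (h.sat_iff e e').1 he⟩⟩

theorem provable_TStar_iff {σ : Formula} (h : σ.IsSentence) : Provable TStar σ ↔ σ ∈ TStar :=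
  ⟨fun hp => ⟨h, fun e => hp.sat e fun _ hγ => hγ.2 e⟩, provable_of_mem⟩

theorem isTheory_TStar : IsTheory TStar := fun _ h => h.1

theorem consistent_TStar : Consistent TStar := consistent_of_sat 0 fun _ h => h.2 0

theorem complete_TStar : Complete TStar := fun σ hσ => by
  by_cases h : σ.Sat 0
  · exact .inl (provable_of_mem ((mem_TStar_iff hσ 0).2 h))
  · exact .inr (provable_of_mem ((mem_TStar_iff (σ := .neg σ) hσ 0).2 h))

end LStar

/-! ### Back and forth between assignments -/

namespace LStar

open Function
open scoped Nat

/-- The value of the linear form with integer coefficients `c` under the assignment `e`. -/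
noncomputable def lin (e : ℕ → ℕ) : (ℕ →₀ ℤ) →ₗ[ℤ] ℤ :=
  Finsupp.linearCombination ℤ fun i => (e i : ℤ)

theorem lin_update (e : ℕ → ℕ) (n a : ℕ) (c : ℕ →₀ ℤ) :
    lin (update e n a) c = lin e (c.erase n) + c n * a := by
  have h : ∀ f : ℕ → ℕ, lin f c = lin f (c.erase n) + c n * f n := fun f => by
    conv_lhs => rw [← Finsupp.erase_add_single n c]
    simp [lin, Finsupp.linearCombination_single]
  rw [h, update_self, add_left_inj]
  simp only [lin, Finsupp.linearCombination_apply]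
  refine Finsupp.sum_congr fun i hi => ?_
  have : i ≠ n := by rintro rfl; simp at hi
  simp [this]

theorem dvd_lin_sub_lin {M : ℤ} {e e' : ℕ → ℕ} (h : ∀ i, M ∣ (e i : ℤ) - e' i) (c : ℕ →₀ ℤ) :
    M ∣ lin e c - lin e' c := by
  simp only [lin, Finsupp.linearCombination_apply, Finsupp.sum, ← Finset.sum_sub_distrib,
    smul_eq_mul, ← mul_sub]
  exact Finset.dvd_sum fun i _ => (h i).mul_left _

/-- Two assignments are similar at level `N` if their values are congruent modulo `N!` and no
inequality between linear forms with coefficients and constant term at most `N` in absolute value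
tells them apart. -/
def Similar (N : ℕ) (e e' : ℕ → ℕ) : Prop :=
  (∀ i, (N ! : ℤ) ∣ (e i : ℤ) - e' i) ∧
    ∀ (c : ℕ →₀ ℤ) (d : ℤ), (∀ i, |c i| ≤ N) → |d| ≤ N →
      (0 < lin e c + d ↔ 0 < lin e' c + d)

theorem Similar.refl (N : ℕ) (e : ℕ → ℕ) : Similar N e e :=
  ⟨fun i => by simp, fun _ _ _ _ => Iff.rfl⟩

theorem Similar.symm {N : ℕ} {e e' : ℕ → ℕ} (h : Similar N e e') : Similar N e' e :=
  ⟨fun i => by simpa using (h.1 i).neg_right, fun c d hc hd => (h.2 c d hc hd).symm⟩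

theorem Similar.mono {N N' : ℕ} (hN : N ≤ N') {e e' : ℕ → ℕ} (h : Similar N' e e') :
    Similar N e e' := by
  have hN' : (N : ℤ) ≤ N' := by exact_mod_cast hN
  exact ⟨fun i => (Int.natCast_dvd_natCast.2 (Nat.factorial_dvd_factorial hN)).trans (h.1 i),
    fun c d hc hd => h.2 c d (fun i => (hc i).trans hN') (hd.trans hN')⟩

/-- The level of similarity that guarantees similarity at level `N` after one more value has been
chosen. -/
def nextLevel (N : ℕ) : ℕ := 2 * N ^ 2 + N ^ 2 * N !

/-- Among the lower bounds `(c · e + d) / m ≤ a` with coefficients at most `N`, there is a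
greatest one; `r` is the distance from it to `a`, multiplied by `m`. -/
theorem exists_greatest_lower_bound {N : ℕ} (hN : 1 ≤ N) (e : ℕ → ℕ) (a : ℕ) :
    ∃ (c : ℕ →₀ ℤ) (d : ℤ) (m r : ℕ), (∀ i, |c i| ≤ N) ∧ |d| ≤ N ∧ 1 ≤ m ∧ m ≤ N ∧
      (m * a : ℤ) = lin e c + d + r ∧
      ∀ (c' : ℕ →₀ ℤ) (d' m' r' : ℤ), (∀ i, |c' i| ≤ N) → |d'| ≤ N → 1 ≤ m' → m' ≤ N → 0 ≤ r' →
        m' * a = lin e c' + d' + r' → m' * r ≤ m * r' := by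
  classical
  let P : ℕ → Prop := fun k => ∃ (c : ℕ →₀ ℤ) (d : ℤ) (m r : ℕ), (∀ i, |c i| ≤ N) ∧ |d| ≤ N ∧
    1 ≤ m ∧ m ≤ N ∧ (m * a : ℤ) = lin e c + d + r ∧ m * k = r * (N !)
  have hP : ∃ k, P k := ⟨a * N !, 0, 0, 1, a, by simp, by simp, le_rfl, hN, by simp, by simp⟩
  obtain ⟨c, d, m, r, hc, hd, hm, hmN, ha, hk⟩ := Nat.find_spec hP
  refine ⟨c, d, m, r, hc, hd, hm, hmN, ha, fun c' d' m' r' hc' hd' hm' hmN' hr' ha' => ?_⟩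
  lift m' to ℕ using by omega
  lift r' to ℕ using hr'
  norm_cast at hm' hmN' ⊢
  obtain ⟨q, hq⟩ : m' ∣ N ! := Nat.dvd_factorial hm' hmN'
  have hle : Nat.find hP ≤ r' * q :=
    Nat.find_min' hP ⟨c', d', m', r', hc', hd', hm', hmN', ha', by rw [hq]; ring⟩
  refine le_of_mul_le_mul_right ?_ (Nat.factorial_pos N)
  calc m' * r * N ! = m' * m * Nat.find hP := by rw [mul_assoc, ← hk, mul_assoc]
    _ ≤ m' * m * (r' * q) := Nat.mul_le_mul_left _ hle
    _ = m * r' * N ! := by rw [hq]; ring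

/-- A remainder `r` can be replaced by a small one in the same residue class, keeping positivity. -/
theorem exists_small_remainder {K : ℕ} (hK : 1 ≤ K) (r : ℕ) :
    ∃ s : ℕ, s ≤ r ∧ s ≤ K ∧ (0 < r → 0 < s) ∧ (K : ℤ) ∣ r - s := by
  rcases Nat.eq_zero_or_pos r with rfl | hr
  · exact ⟨0, by simp⟩
  · refine ⟨(r - 1) % K + 1, ?_, Nat.mod_lt _ hK, by simp, ?_⟩
    · have := Nat.mod_le (r - 1) K
      omega
    · refine ⟨((r - 1) / K : ℕ), ?_⟩
      have := Nat.div_add_mod (r - 1) K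
      push_cast
      have h : ((r - 1 : ℕ) : ℤ) = K * ((r - 1) / K : ℕ) + ((r - 1) % K : ℕ) := by
        exact_mod_cast this.symm
      push_cast [hr] at h ⊢
      linarith

/-- One step back and forth. Writing `a` as its greatest lower bound among the linear forms plus a
remainder, `a'` is obtained from the value of the same form under `e'` by adding a remainder that
is small, but positive whenever the former is, and in the same residue class. -/
theorem Similar.exists_update {N : ℕ} (hN : 1 ≤ N) {e e' : ℕ → ℕ}
    (h : Similar (nextLevel N) e e') (n a : ℕ) :
    ∃ a' : ℕ, Similar N (update e n a) (update e' n a') ∧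
      ∃ c : ℕ →₀ ℤ, (∀ i, |c i| ≤ N) ∧ (a' : ℤ) ≤ lin e' c + N + N * N ! := by
  obtain ⟨c, d, m, r, hc, hd, hm, hmN, ha, hmax⟩ := exists_greatest_lower_bound hN e a
  obtain ⟨s, hsr, hsK, hs0, hdvd⟩ :=
    exists_small_remainder (K := m * N !) (Nat.mul_pos hm (Nat.factorial_pos N)) r
  have hF : 1 ≤ N ! := Nat.factorial_pos N
  have hNl : N ≤ nextLevel N := by unfold nextLevel; nlinarith
  have hK : m * N ! ∣ (nextLevel N) ! := by
    have : m * N ! ∣ (N + m) ! := by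
      rw [mul_comm]
      exact (Nat.mul_dvd_mul_left _ (Nat.dvd_factorial hm le_rfl)).trans
        (Nat.factorial_mul_factorial_dvd_factorial_add N m)
    exact this.trans (Nat.factorial_dvd_factorial (by unfold nextLevel; nlinarith))
  -- `0` is a lower bound for `a`, hence the greatest lower bound is nonnegative
  have hpos : 0 ≤ lin e' c + d := by
    have h0 : 0 ≤ lin e c + d := by
      have := hmax 0 0 1 a (by simp) (by simp) le_rfl (by exact_mod_cast hN) (by simp) (by simp)
      linarith
    have := (not_congr ((h.mono hNl).2 (-c) (-d) (by simpa using hc) (by simpa using hd))).1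
      (by simp; linarith)
    simp at this
    linarith
  have hdvd' : ((m * N ! : ℕ) : ℤ) ∣ (lin e c + d + r) - (lin e' c + d + s) := by
    have h₁ := dvd_lin_sub_lin
      (fun i => (Int.natCast_dvd_natCast.2 hK).trans (h.1 i)) c
    have h₂ := h₁.add hdvd
    rwa [show lin e c - lin e' c + ((r : ℤ) - s) =
      (lin e c + d + r) - (lin e' c + d + s) by ring] at h₂
  obtain ⟨a', ha'⟩ : ∃ a' : ℕ, (m * a' : ℤ) = lin e' c + d + s := by
    have h₁ : (m : ℤ) ∣ lin e' c + d + s := by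
      have h₂ : (m : ℤ) ∣ (lin e c + d + r) - (lin e' c + d + s) :=
        dvd_trans ⟨(N ! : ℤ), by push_cast; ring⟩ hdvd'
      rw [← ha] at h₂
      simpa using (dvd_mul_right (m : ℤ) a).sub h₂
    obtain ⟨q, hq⟩ := h₁
    have hq0 : 0 ≤ q := by
      by_contra hlt
      have : (m : ℤ) * q < 0 := mul_neg_of_pos_of_neg (by exact_mod_cast hm) (by linarith)
      have : (0 : ℤ) ≤ s := by positivity
      linarith
    lift q to ℕ using hq0
    exact ⟨q, hq.symm⟩
  have hm0 : (0 : ℤ) < m := by exact_mod_cast hm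
  have hmN' : (m : ℤ) ≤ N := by exact_mod_cast hmN
  have hsK' : (s : ℤ) ≤ m * N ! := by exact_mod_cast hsK
  refine ⟨a', ⟨fun i => ?_, fun c₁ d₁ hc₁ hd₁ => ?_⟩, c, hc, ?_⟩
  · by_cases hi : i = n
    · subst hi
      rw [← ha, ← ha', ← mul_sub] at hdvd'
      push_cast at hdvd'
      simpa using (mul_dvd_mul_iff_left hm0.ne').1 hdvd'
    · simpa [hi] using (h.mono hNl).1 i
  · -- multiply the form by `m` to express it through `e`, respectively `e'`, and the remainder
    rw [lin_update, lin_update]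
    set k := c₁ n with hk
    set c₂ := c₁.erase n with hc₂
    have hc₂N : ∀ i, |c₂ i| ≤ N := fun i => by
      by_cases hi : i = n
      · simp [hc₂, hi]
      · simpa [hc₂, hi] using hc₁ i
    have hkN : |k| ≤ N := hc₁ n
    have key : 0 < lin e (m • c₂ + k • c) + (m * d₁ + k * d + k * s) ↔
        0 < lin e' (m • c₂ + k • c) + (m * d₁ + k * d + k * s) := by
      have bd : ∀ u v : ℤ, |u| ≤ N → |v| ≤ N → |m * u + k * v| ≤ 2 * N ^ 2 := fun u v hu hv => by
        calc |m * u + k * v| ≤ |(m : ℤ) * u| + |k * v| := abs_add_le _ _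
          _ = m * |u| + |k| * |v| := by rw [abs_mul, abs_mul, Nat.abs_cast]
          _ ≤ N * N + N * N := by gcongr
          _ = 2 * N ^ 2 := by ring
      refine h.2 _ _ (fun i => ?_) ?_
      · have := bd (c₂ i) (c i) (hc₂N i) (hc i)
        simp only [Finsupp.add_apply, Finsupp.smul_apply, smul_eq_mul, nsmul_eq_mul]
        refine this.trans ?_
        unfold nextLevel
        push_cast
        have : (0 : ℤ) ≤ N ^ 2 * N ! := by positivity
        linarith
      · calc |m * d₁ + k * d + k * s| ≤ |m * d₁ + k * d| + |k * s| := abs_add_le _ _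
          _ ≤ 2 * N ^ 2 + N * (N * N !) := by
            rw [abs_mul k, Nat.abs_cast]
            have : (s : ℤ) ≤ N * N ! := hsK'.trans (by gcongr)
            gcongr
            exact bd _ _ hd₁ hd
          _ = nextLevel N := by unfold nextLevel; push_cast; ring
    have hlin : ∀ f : ℕ → ℕ, lin f (m • c₂ + k • c) = m * lin f c₂ + k * lin f c := fun f => by
      simp
    rw [hlin, hlin] at key
    rw [← mul_pos_iff_of_pos_left hm0 (b := lin e c₂ + k * a + d₁),
      ← mul_pos_iff_of_pos_left hm0 (b := lin e' c₂ + k * a' + d₁)]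
    have e₁ : (m : ℤ) * (lin e c₂ + k * a + d₁) =
        m * lin e c₂ + k * lin e c + (m * d₁ + k * d) + k * r := by
      linear_combination k * ha
    have e₂ : (m : ℤ) * (lin e' c₂ + k * a' + d₁) =
        m * lin e' c₂ + k * lin e' c + (m * d₁ + k * d + k * s) := by
      linear_combination k * ha'
    rw [e₂, ← key, e₁]
    have hsr' : (s : ℤ) ≤ r := by exact_mod_cast hsr
    rcases Nat.eq_zero_or_pos r with hr0 | hr0
    · obtain rfl : s = 0 := by omega
      simp [hr0, add_assoc]
    have hs0' : (0 : ℤ) < s := by exact_mod_cast hs0 hr0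
    rcases lt_trichotomy k 0 with hk0 | hk0 | hk0
    · constructor <;> intro hlt
      · nlinarith
      · by_contra hle
        have hle' : lin e c₂ + k * a + d₁ ≤ 0 := by
          by_contra hgt
          have := mul_pos hm0 (not_le.1 hgt)
          linarith
        have := hmax c₂ d₁ (-k) (-(lin e c₂ + k * a + d₁)) hc₂N hd₁ (by omega)
          ((neg_le_abs k).trans hkN) (by linarith) (by ring)
        nlinarith
    · simp [hk0]
    · constructor <;> intro hlt
      · have hgt : 0 ≤ lin e c₂ + k * a + d₁ := by
          by_contra hgt
          have := mul_neg_of_pos_of_neg hm0 (not_le.1 hgt)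
          linarith
        have := hmax (-c₂) (-d₁) k (lin e c₂ + k * a + d₁) (by simpa using hc₂N)
          (by simpa using hd₁) hk0 ((le_abs_self k).trans hkN) hgt (by simp; ring)
        nlinarith
      · nlinarith
  · have h₁ : (a' : ℤ) ≤ m * a' := by nlinarith [Int.natCast_nonneg a']
    have h₂ : (m * N ! : ℤ) ≤ N * N ! := by gcongr
    have h₃ := (le_abs_self d).trans hd
    linarith

end LStar

/-! ### Bounded quantification suffices -/

namespace LStar

open Function

theorem le_nextLevel (N : ℕ) : N ≤ nextLevel N := by
  unfold nextLevel
  nlinarith [Nat.zero_le (N ^ 2 * N.factorial), Nat.le_mul_self N]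

/-- A bound for the coefficients of the linear forms that represent the term. -/
def Term.weight : Term → ℕ
  | var _ => 1
  | zero => 1
  | one => 1
  | plus s t => s.weight + t.weight
  | nu t => 33 + 16 * t.weight

/-- `ν` flips parities, so the parities of the variables determine which linear form a term
takes the values of. -/
theorem Term.exists_lin (t : Term) {e e' : ℕ → ℕ} (h : ∀ i, (2 : ℤ) ∣ (e i : ℤ) - e' i) :
    ∃ (c : ℕ →₀ ℤ) (d : ℤ), (∀ i, |c i| ≤ t.weight) ∧ |d| ≤ t.weight ∧
      (t.eval e : ℤ) = lin e c + d ∧ (t.eval e' : ℤ) = lin e' c + d := by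
  induction t with
  | var n =>
    refine ⟨Finsupp.single n 1, 0, fun i => ?_, by simp, ?_, ?_⟩
    · by_cases hi : n = i <;> simp [hi, weight]
    all_goals simp [eval, lin]
  | zero => exact ⟨0, 0, by simp, by simp, by simp [eval], by simp [eval]⟩
  | one => exact ⟨0, 1, by simp, by simp [weight], by simp [eval], by simp [eval]⟩
  | plus s t hs ht =>
    obtain ⟨c₁, d₁, hc₁, hd₁, h₁, h₁'⟩ := hs
    obtain ⟨c₂, d₂, hc₂, hd₂, h₂, h₂'⟩ := ht
    refine ⟨c₁ + c₂, d₁ + d₂, fun i => ?_, ?_, ?_, ?_⟩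
    · rw [Finsupp.add_apply, weight, Nat.cast_add]
      exact (abs_add_le _ _).trans (add_le_add (hc₁ i) (hc₂ i))
    · rw [weight, Nat.cast_add]
      exact (abs_add_le _ _).trans (add_le_add hd₁ hd₂)
    · rw [eval, Nat.cast_add, h₁, h₂, map_add]; ring
    · rw [eval, Nat.cast_add, h₁', h₂', map_add]; ring
  | nu t ht =>
    obtain ⟨c, d, hc, hd, h₁, h₁'⟩ := ht
    have hpar : Even (t.eval e) ↔ Even (t.eval e') := by
      have := dvd_lin_sub_lin h c
      rw [← add_sub_add_right_eq_sub _ _ d, ← h₁, ← h₁'] at this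
      simp only [Nat.even_iff]
      omega
    have hc' : ∀ i, |((16 : ℤ) • c) i| ≤ (nu t).weight := fun i => by
      rw [Finsupp.smul_apply, smul_eq_mul, abs_mul, weight]
      push_cast
      have := hc i
      norm_num
      linarith
    rw [abs_le] at hd
    by_cases he : Even (t.eval e)
    · refine ⟨(16 : ℤ) • c, 33 + 16 * d, hc', ?_, ?_, ?_⟩
      · rw [weight, abs_le]; push_cast; constructor <;> linarith
      · rw [eval, nuStar, if_pos he]; push_cast; rw [h₁, map_smul, smul_eq_mul]; ring
      · rw [eval, nuStar, if_pos (hpar.1 he)]; push_cast; rw [h₁', map_smul, smul_eq_mul]; ring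
    · refine ⟨(16 : ℤ) • c, 16 + 16 * d, hc', ?_, ?_, ?_⟩
      · rw [weight, abs_le]; push_cast; constructor <;> linarith
      · rw [eval, nuStar, if_neg he]; push_cast; rw [h₁, map_smul, smul_eq_mul]; ring
      · rw [eval, nuStar, if_neg (mt hpar.2 he)]; push_cast; rw [h₁', map_smul, smul_eq_mul]; ring

theorem Term.lt_iff_of_similar (s t : Term) {e e' : ℕ → ℕ}
    (h : Similar (s.weight + t.weight + 2) e e') :
    s.eval e < t.eval e ↔ s.eval e' < t.eval e' := by
  have h2 : ∀ i, (2 : ℤ) ∣ (e i : ℤ) - e' i := fun i =>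
    dvd_trans (by exact_mod_cast Nat.dvd_factorial (by omega) (by omega)) (h.1 i)
  obtain ⟨c₁, d₁, hc₁, hd₁, h₁, h₁'⟩ := s.exists_lin h2
  obtain ⟨c₂, d₂, hc₂, hd₂, h₂, h₂'⟩ := t.exists_lin h2
  have key := h.2 (c₂ - c₁) (d₂ - d₁) (fun i => by
      rw [Finsupp.sub_apply]
      have := (abs_sub (c₂ i) (c₁ i)).trans (add_le_add (hc₂ i) (hc₁ i))
      push_cast
      linarith) (by
      have := (abs_sub d₂ d₁).trans (add_le_add hd₂ hd₁)
      push_cast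
      linarith)
  rw [map_sub, map_sub] at key
  zify
  rw [h₁, h₂, h₁', h₂', ← sub_pos, ← sub_pos (b := lin e' c₁ + d₁)]
  convert key using 2 <;> ring

namespace Formula

/-- A level of similarity at which assignments satisfy the same formulas. -/
def level : Formula → ℕ
  | eq s t => s.weight + t.weight + 2
  | lt s t => s.weight + t.weight + 2
  | neg φ => φ.level
  | and φ ψ => φ.level + ψ.level
  | or φ ψ => φ.level + ψ.level
  | imp φ ψ => φ.level + ψ.level
  | iff φ ψ => φ.level + ψ.level
  | all _ φ => nextLevel φ.level
  | ex _ φ => nextLevel φ.level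

theorem one_le_level (φ : Formula) : 1 ≤ φ.level := by
  induction φ with
  | eq | lt => simp only [level]; omega
  | neg φ ih => exact ih
  | and φ ψ h₁ h₂ | or φ ψ h₁ h₂ | imp φ ψ h₁ h₂ | iff φ ψ h₁ h₂ => simp only [level]; omega
  | all n φ ih | ex n φ ih => exact ih.trans (le_nextLevel _)

theorem sat_iff_of_similar {φ : Formula} {e e' : ℕ → ℕ} (h : Similar φ.level e e') :
    φ.Sat e ↔ φ.Sat e' := by
  induction φ generalizing e e' with
  | lt s t => exact s.lt_iff_of_similar t h
  | eq s t =>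
    have h₁ := s.lt_iff_of_similar t h
    have h₂ := t.lt_iff_of_similar s (by rwa [add_comm t.weight])
    simp only [Sat]
    omega
  | neg φ ih => simp only [Sat, ih h]
  | and φ ψ h₁ h₂ | or φ ψ h₁ h₂ | imp φ ψ h₁ h₂ | iff φ ψ h₁ h₂ =>
    simp only [Sat, h₁ (h.mono (Nat.le_add_right _ _)), h₂ (h.mono (Nat.le_add_left _ _))]
  | all n φ ih =>
    constructor <;> intro hs a
    · obtain ⟨a', ha', -⟩ := h.symm.exists_update φ.one_le_level n a
      exact (ih ha').2 (hs a')
    · obtain ⟨a', ha', -⟩ := h.exists_update φ.one_le_level n a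
      exact (ih ha').2 (hs a')
  | ex n φ ih =>
    constructor <;> rintro ⟨a, ha⟩
    · obtain ⟨a', ha', -⟩ := h.exists_update φ.one_le_level n a
      exact ⟨a', (ih ha').1 ha⟩
    · obtain ⟨a', ha', -⟩ := h.symm.exists_update φ.one_le_level n a
      exact ⟨a', (ih ha').1 ha⟩

end Formula

/-- The assignment given by a list of pairs of a variable and its value; earlier entries take
precedence, and variables that do not occur have the value `0`. -/
def env (l : List (ℕ × ℕ)) (i : ℕ) : ℕ := (l.lookup i).getD 0

theorem env_cons (n a : ℕ) (l : List (ℕ × ℕ)) : env ((n, a) :: l) = update (env l) n a := by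
  funext i
  by_cases h : i = n
  · simp [env, h]
  · simp [env, List.lookup_cons, h, beq_eq_false_iff_ne.2 h]

/-- How far to search for a witness of an existential quantifier in front of a formula of level
`N`, given the values of the variables. -/
def searchBound (N : ℕ) (l : List (ℕ × ℕ)) : ℕ := N * (l.map Prod.snd).sum + N + N * N.factorial

theorem lin_env_le {N : ℕ} (l : List (ℕ × ℕ)) {c : ℕ →₀ ℤ} (hc : ∀ i, |c i| ≤ N) :
    lin (env l) c ≤ N * ((l.map Prod.snd).sum : ℕ) := by
  induction l generalizing c with
  | nil => simp [lin, Finsupp.linearCombination_apply, env]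
  | cons p l ih =>
    obtain ⟨n, a⟩ := p
    rw [env_cons, lin_update]
    have h₁ := ih (c := c.erase n) fun i => by
      by_cases hi : i = n
      · simp [hi]
      · simpa [hi] using hc i
    have h₂ : c n * a ≤ N * a := by gcongr; exact (le_abs_self _).trans (hc n)
    simp only [List.map_cons, List.sum_cons]
    push_cast at h₁ ⊢
    linarith

/-- The search for a witness of an existential quantifier can be bounded. -/
theorem Formula.exists_sat_update_iff (φ : Formula) (n : ℕ) (l : List (ℕ × ℕ)) :
    (∃ a, φ.Sat (update (env l) n a)) ↔
      ∃ a < searchBound φ.level l + 1, φ.Sat (env ((n, a) :: l)) := by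
  constructor
  · rintro ⟨a, ha⟩
    obtain ⟨a', ha', c, hc, hle⟩ :=
      (Similar.refl _ (env l)).exists_update φ.one_le_level n a
    refine ⟨a', ?_, by rw [env_cons]; exact (sat_iff_of_similar ha').1 ha⟩
    rw [Nat.lt_succ_iff, searchBound]
    zify
    have := lin_env_le l hc
    push_cast at this ⊢
    linarith
  · rintro ⟨a, -, ha⟩
    exact ⟨a, by rwa [env_cons] at ha⟩

end LStar

/-! ### Compilation of formulas into codes of partial recursive functions -/

namespace LStar

open Function Nat.Partrec Encodable

theorem exists_code_of_primrec {α σ : Type*} [Primcodable α] [Primcodable σ] {f : α → σ}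
    (hf : Primrec f) : ∃ c : Code, ∀ a, c.eval (encode a) = Part.some (encode (f a)) := by
  obtain ⟨c, hc⟩ := Code.exists_code.1 (Nat.Partrec.of_primrec (Nat.Primrec.pred.comp hf))
  exact ⟨c, fun a => by simp [hc]⟩

theorem eval_comp_of_eq_some {cf cg : Code} {n a : ℕ} (h : cg.eval n = Part.some a) :
    (cf.comp cg).eval n = cf.eval a := by
  change Part.bind (cg.eval n) (fun m => cf.eval m) = _
  rw [h, Part.bind_some]

theorem eval_pair_of_eq_some {cf cg : Code} {n a b : ℕ} (hf : cf.eval n = Part.some a)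
    (hg : cg.eval n = Part.some b) : (cf.pair cg).eval n = Part.some (Nat.pair a b) := by
  simp [Code.eval, hf, hg, Seq.seq]

theorem eval_right (a b : ℕ) : Code.right.eval (Nat.pair a b) = Part.some b := by
  simp [Code.eval]

/-- A code for the primitive recursive function `f`. -/
noncomputable def codeOf {α σ : Type*} [Primcodable α] [Primcodable σ] (f : α → σ)
    (hf : Primrec f) : Code := (exists_code_of_primrec hf).choose

theorem eval_codeOf {α σ : Type*} [Primcodable α] [Primcodable σ] {f : α → σ}
    (hf : Primrec f) (a : α) : (codeOf f hf).eval (encode a) = Part.some (encode (f a)) :=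
  (exists_code_of_primrec hf).choose_spec a

theorem primrec_factorial : Primrec Nat.factorial := by
  refine (Primrec.nat_rec₁ (f := fun n r => (n + 1) * r) 1 ?_).of_eq fun n => ?_
  · exact Primrec.nat_mul.comp (Primrec.succ.comp Primrec.fst) Primrec.snd
  · induction n with
    | zero => rfl
    | succ n ih => rw [Nat.factorial_succ, ← ih]

theorem primrec_nextLevel : Primrec nextLevel := by
  have hsq : Primrec fun N : ℕ => N * N := Primrec.nat_mul.comp .id .id
  refine (Primrec.nat_add.comp (Primrec.nat_mul.comp (.const 2) hsq)
    (Primrec.nat_mul.comp hsq primrec_factorial)).of_eq fun N => ?_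
  simp only [nextLevel, sq]

theorem primrec_searchBound : Primrec₂ searchBound := by
  have hsum : Primrec fun p : ℕ × List (ℕ × ℕ) => (p.2.map Prod.snd).sum := by
    refine (Primrec.list_foldr (f := fun p : ℕ × List (ℕ × ℕ) => p.2) (g := fun _ => 0)
      (h := fun _ q => q.1.2 + q.2) Primrec.snd (.const 0) ?_).of_eq fun p => ?_
    · exact Primrec.nat_add.comp (Primrec.snd.comp (Primrec.fst.comp Primrec.snd))
        (Primrec.snd.comp Primrec.snd)
    · rw [List.sum, List.foldr_map]
  exact Primrec.nat_add.comp (Primrec.nat_add.comp (Primrec.nat_mul.comp .fst hsum) .fst)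
    (Primrec.nat_mul.comp .fst (primrec_factorial.comp .fst))

theorem primrec_env : Primrec₂ fun (i : ℕ) (l : List (ℕ × ℕ)) => env l i :=
  Primrec.option_getD.comp Primrec.listLookup (.const 0)

theorem primrec_nuStar : Primrec nuStar := by
  have h : ∀ k, Primrec fun n : ℕ => k + 16 * n := fun k =>
    Primrec.nat_add.comp (.const k) (Primrec.nat_mul.comp (.const 16) .id)
  refine (Primrec.ite (Primrec.eq.comp (Primrec.nat_mod.comp .id (.const 2)) (.const 0))
    (h 33) (h 16)).of_eq fun n => ?_
  simp only [nuStar, Nat.even_iff, id]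

theorem primrec_eqOp : Primrec₂ fun a b : ℕ => if a = b then 1 else 0 :=
  Primrec.ite Primrec.eq (.const 1) (.const 0)

theorem primrec_ltOp : Primrec₂ fun a b : ℕ => if a < b then 1 else 0 :=
  Primrec.ite Primrec.nat_lt (.const 1) (.const 0)

/-- The code `c` computes the function `f` of (lists representing) assignments. -/
def Computes (c : Code) (f : List (ℕ × ℕ) → ℕ) : Prop :=
  ∀ l, c.eval (encode l) = Part.some (f l)

/-- The code of `l ↦ f (g l) (h l)`, given codes of `g` and `h`. -/
noncomputable def opCode (f : ℕ → ℕ → ℕ) (hf : Primrec₂ f) (c₁ c₂ : Code) : Code :=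
  (codeOf (fun p : ℕ × ℕ => f p.1 p.2) hf).comp (c₁.pair c₂)

theorem Computes.opCode {f : ℕ → ℕ → ℕ} (hf : Primrec₂ f) {c₁ c₂ : Code}
    {g h : List (ℕ × ℕ) → ℕ} (h₁ : Computes c₁ g) (h₂ : Computes c₂ h) :
    Computes (opCode f hf c₁ c₂) fun l => f (g l) (h l) := fun l => by
  have := eval_codeOf (f := fun p : ℕ × ℕ => f p.1 p.2) hf (g l, h l)
  simp only [encode_prod_val, encode_nat] at this
  rwa [LStar.opCode, eval_comp_of_eq_some (eval_pair_of_eq_some (h₁ l) (h₂ l))]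

theorem primrec_opCode {f : ℕ → ℕ → ℕ} (hf : Primrec₂ f) : Primrec₂ (opCode f hf) :=
  Code.primrec₂_comp.comp (.const _) Code.primrec₂_pair

/-- The code of `l ↦ env l n`. -/
noncomputable def varCode (n : ℕ) : Code :=
  (codeOf (fun p : ℕ × List (ℕ × ℕ) => env p.2 p.1) primrec_env).comp
    ((Code.const n).pair Code.id)

theorem computes_varCode (n : ℕ) : Computes (varCode n) fun l => env l n := fun l => by
  have := eval_codeOf (f := fun p : ℕ × List (ℕ × ℕ) => env p.2 p.1) primrec_env (n, l)
  simp only [encode_prod_val, encode_nat] at this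
  rwa [varCode, eval_comp_of_eq_some
    (eval_pair_of_eq_some (Code.eval_const _ _) (Code.eval_id _))]

theorem primrec_varCode : Primrec varCode :=
  Code.primrec₂_comp.comp (.const _)
    (Code.primrec₂_pair.comp Code.primrec_const (.const _))

/-- The code of `l ↦ nuStar (g l)`, given a code of `g`. -/
noncomputable def nuCode (c : Code) : Code := (codeOf nuStar primrec_nuStar).comp c

theorem Computes.nuCode {c : Code} {g : List (ℕ × ℕ) → ℕ} (h : Computes c g) :
    Computes (nuCode c) fun l => nuStar (g l) := fun l => by
  have := eval_codeOf primrec_nuStar (g l)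
  simp only [encode_nat] at this
  rwa [LStar.nuCode, eval_comp_of_eq_some (h l)]

theorem primrec_nuCode : Primrec nuCode := Code.primrec₂_comp.comp (.const _) .id

/-! Truth values are `1` and `0`, so that `eqCode` serves for biconditionals as well, and also for
negation, which is equality with `0`. -/

noncomputable def eqCode : Code → Code → Code := opCode _ primrec_eqOp
noncomputable def ltCode : Code → Code → Code := opCode _ primrec_ltOp
noncomputable def plusCode : Code → Code → Code := opCode _ Primrec.nat_add
noncomputable def andCode : Code → Code → Code := opCode _ Primrec.nat_mul
noncomputable def negCode (c : Code) : Code := eqCode c (Code.const 0)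
noncomputable def orCode (c₁ c₂ : Code) : Code := negCode (andCode (negCode c₁) (negCode c₂))
noncomputable def impCode (c₁ c₂ : Code) : Code := negCode (andCode c₁ (negCode c₂))

theorem primrec_eqCode : Primrec₂ eqCode := primrec_opCode _
theorem primrec_ltCode : Primrec₂ ltCode := primrec_opCode _
theorem primrec_plusCode : Primrec₂ plusCode := primrec_opCode _
theorem primrec_andCode : Primrec₂ andCode := primrec_opCode _
theorem primrec_negCode : Primrec negCode := primrec_eqCode.comp .id (.const _)
theorem primrec_orCode : Primrec₂ orCode :=
  primrec_negCode.comp₂ (primrec_andCode.comp₂ (primrec_negCode.comp₂ .left)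
    (primrec_negCode.comp₂ .right))
theorem primrec_impCode : Primrec₂ impCode :=
  primrec_negCode.comp₂ (primrec_andCode.comp₂ .left (primrec_negCode.comp₂ .right))

theorem computes_const (n : ℕ) : Computes (Code.const n) fun _ => n :=
  fun _ => Code.eval_const _ _

open Classical in
/-- The code `c` decides the set `p` of assignments. -/
def Decides (c : Code) (p : List (ℕ × ℕ) → Prop) : Prop :=
  Computes c fun l => if p l then 1 else 0

theorem Computes.congr {c : Code} {f g : List (ℕ × ℕ) → ℕ} (h : Computes c f)
    (hfg : ∀ l, f l = g l) : Computes c g := fun l => by rw [h l, hfg]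

theorem Computes.eqCode {c₁ c₂ : Code} {f g : List (ℕ × ℕ) → ℕ} (h₁ : Computes c₁ f)
    (h₂ : Computes c₂ g) : Decides (eqCode c₁ c₂) fun l => f l = g l :=
  (h₁.opCode primrec_eqOp h₂).congr fun l => by congr

theorem Computes.ltCode {c₁ c₂ : Code} {f g : List (ℕ × ℕ) → ℕ} (h₁ : Computes c₁ f)
    (h₂ : Computes c₂ g) : Decides (ltCode c₁ c₂) fun l => f l < g l :=
  (h₁.opCode primrec_ltOp h₂).congr fun l => by congr

section

variable {c c₁ c₂ : Code} {p p₁ p₂ : List (ℕ × ℕ) → Prop}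

theorem Decides.congr (h : Decides c p₁) (hp : ∀ l, p₁ l ↔ p₂ l) : Decides c p₂ :=
  Computes.congr h fun l => by congr 1; exact propext (hp l)

theorem Decides.negCode (h : Decides c p) : Decides (negCode c) fun l => ¬ p l :=
  (Computes.eqCode h (computes_const 0)).congr fun l => by simp

theorem Decides.andCode (h₁ : Decides c₁ p₁) (h₂ : Decides c₂ p₂) :
    Decides (andCode c₁ c₂) fun l => p₁ l ∧ p₂ l :=
  (Computes.opCode Primrec.nat_mul h₁ h₂).congr fun l => by
    by_cases h : p₁ l <;> by_cases h' : p₂ l <;> simp [h, h']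

theorem Decides.orCode (h₁ : Decides c₁ p₁) (h₂ : Decides c₂ p₂) :
    Decides (orCode c₁ c₂) fun l => p₁ l ∨ p₂ l :=
  (h₁.negCode.andCode h₂.negCode).negCode.congr fun l => by tauto

theorem Decides.impCode (h₁ : Decides c₁ p₁) (h₂ : Decides c₂ p₂) :
    Decides (impCode c₁ c₂) fun l => p₁ l → p₂ l :=
  (h₁.andCode h₂.negCode).negCode.congr fun l => by tauto

theorem Decides.iffCode (h₁ : Decides c₁ p₁) (h₂ : Decides c₂ p₂) :
    Decides (eqCode c₁ c₂) fun l => p₁ l ↔ p₂ l :=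
  (Computes.eqCode h₁ h₂).congr fun l => by by_cases h : p₁ l <;> by_cases h' : p₂ l <;> simp [h, h']

end

theorem primrec_searchBound_succ :
    Primrec fun p : ℕ × List (ℕ × ℕ) => searchBound p.1 p.2 + 1 :=
  Primrec.succ.comp primrec_searchBound

theorem primrec_extend : Primrec fun p : ℕ × List (ℕ × ℕ) × ℕ × ℕ => (p.1, p.2.2.1) :: p.2.1 :=
  Primrec.list_cons.comp
    (Primrec.fst.pair (Primrec.fst.comp (Primrec.snd.comp Primrec.snd)))
    (Primrec.fst.comp Primrec.snd)

/-- The code of `(l, k) ↦ max_{a < k} f ((n, a) :: l)`, given a code `c` of `f`. -/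
noncomputable def searchCode (n : ℕ) (c : Code) : Code :=
  (Code.const 0).prec (opCode _ Primrec.nat_max (Code.right.comp Code.right)
    (c.comp ((codeOf _ primrec_extend).comp ((Code.const n).pair Code.id))))

theorem primrec_searchCode : Primrec₂ searchCode :=
  Code.primrec₂_prec.comp (.const _) ((primrec_opCode _).comp (.const _)
    (Code.primrec₂_comp.comp .snd (Code.primrec₂_comp.comp (.const _)
      (Code.primrec₂_pair.comp (Code.primrec_const.comp .fst) (.const _)))))

open Classical in
theorem Decides.eval_searchCode {c : Code} {p : List (ℕ × ℕ) → Prop} (h : Decides c p)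
    (n : ℕ) (l : List (ℕ × ℕ)) (k : ℕ) :
    (searchCode n c).eval (Nat.pair (encode l) k) =
      Part.some (if ∃ a < k, p ((n, a) :: l) then 1 else 0) := by
  induction k with
  | zero => simp [searchCode, Code.eval_prec_zero, Code.eval_const]
  | succ k ih =>
    rw [searchCode, Code.eval_prec_succ, ← searchCode, ih]
    set v := if ∃ a < k, p ((n, a) :: l) then 1 else 0 with hv
    have h₁ := eval_codeOf primrec_extend (n, l, k, v)
    simp only [encode_prod_val, encode_nat] at h₁
    have h₂ := eval_codeOf (f := fun q : ℕ × ℕ => max q.1 q.2) Primrec.nat_max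
      (v, if p ((n, k) :: l) then 1 else 0)
    simp only [encode_prod_val, encode_nat] at h₂
    have h₃ : max v (if p ((n, k) :: l) then 1 else 0) =
        if ∃ a < k + 1, p ((n, a) :: l) then 1 else 0 := by
      simp only [hv, Nat.lt_succ_iff_lt_or_eq, or_and_right, exists_or, exists_eq_left]
      by_cases hq : ∃ a < k, p ((n, a) :: l) <;> by_cases hk : p ((n, k) :: l) <;> simp [hq, hk]
    rw [← h₃]
    rw [Part.bind_eq_bind, Part.bind_some, opCode,
      eval_comp_of_eq_some (eval_pair_of_eq_some ?_ ?_), h₂]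
    · rw [eval_comp_of_eq_some (eval_right _ _), eval_right]
    · rw [eval_comp_of_eq_some, h]
      rw [eval_comp_of_eq_some (eval_pair_of_eq_some (Code.eval_const _ _) (Code.eval_id _)), h₁]

/-- The code deciding an existential quantification over the variable `n`, given the level `N` of
the quantified formula and a code deciding it. -/
noncomputable def exCode (n N : ℕ) (c : Code) : Code :=
  (searchCode n c).comp
    (Code.id.pair ((codeOf _ primrec_searchBound_succ).comp ((Code.const N).pair Code.id)))

/-- As `exCode`, for a universal quantification. -/
noncomputable def allCode (n N : ℕ) (c : Code) : Code := negCode (exCode n N (negCode c))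

theorem primrec_exCode : Primrec fun p : ℕ × ℕ × Code => exCode p.1 p.2.1 p.2.2 :=
  Code.primrec₂_comp.comp
    (primrec_searchCode.comp .fst (Primrec.snd.comp .snd))
    (Code.primrec₂_pair.comp (.const _) (Code.primrec₂_comp.comp (.const _)
      (Code.primrec₂_pair.comp (Code.primrec_const.comp (Primrec.fst.comp .snd)) (.const _))))

theorem primrec_allCode : Primrec fun p : ℕ × ℕ × Code => allCode p.1 p.2.1 p.2.2 :=
  primrec_negCode.comp (primrec_exCode.comp (Primrec.fst.pair
    ((Primrec.fst.comp .snd).pair (primrec_negCode.comp (Primrec.snd.comp .snd)))))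

theorem Decides.exCode {φ : Formula} {c : Code} (h : Decides c fun l => φ.Sat (env l)) (n : ℕ) :
    Decides (exCode n φ.level c) fun l => (Formula.ex n φ).Sat (env l) := fun l => by
  have h₁ := eval_codeOf primrec_searchBound_succ (φ.level, l)
  simp only [encode_prod_val, encode_nat] at h₁
  rw [LStar.exCode, eval_comp_of_eq_some (eval_pair_of_eq_some (Code.eval_id _)
    ((eval_comp_of_eq_some (eval_pair_of_eq_some (Code.eval_const _ _) (Code.eval_id _))).trans
      h₁)), h.eval_searchCode]
  congr 2
  exact propext (φ.exists_sat_update_iff n l).symm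

theorem Decides.allCode {φ : Formula} {c : Code} (h : Decides c fun l => φ.Sat (env l)) (n : ℕ) :
    Decides (allCode n φ.level c) fun l => (Formula.all n φ).Sat (env l) :=
  (Decides.exCode (φ := φ.neg) h.negCode n).negCode.congr fun l => by simp [Formula.Sat]

/-- The code computing the value of a term. -/
noncomputable def Term.code : Term → Code
  | var n => varCode n
  | zero => Code.const 0
  | one => Code.const 1
  | plus s t => plusCode s.code t.code
  | nu t => nuCode t.code

theorem Term.computes_code (t : Term) : Computes t.code fun l => t.eval (env l) := by
  induction t with
  | var n => exact computes_varCode n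
  | zero => exact computes_const 0
  | one => exact computes_const 1
  | plus s t hs ht => exact hs.opCode Primrec.nat_add ht
  | nu t ht => exact ht.nuCode

/-- The code deciding a formula, with the search for witnesses bounded by `searchBound`. -/
noncomputable def Formula.code : Formula → Code
  | eq s t => eqCode s.code t.code
  | lt s t => ltCode s.code t.code
  | neg φ => negCode φ.code
  | and φ ψ => andCode φ.code ψ.code
  | or φ ψ => orCode φ.code ψ.code
  | imp φ ψ => impCode φ.code ψ.code
  | iff φ ψ => eqCode φ.code ψ.code
  | all n φ => allCode n φ.level φ.code
  | ex n φ => exCode n φ.level φ.code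

theorem Formula.decides_code (φ : Formula) : Decides φ.code fun l => φ.Sat (env l) := by
  induction φ with
  | eq s t => exact s.computes_code.eqCode t.computes_code
  | lt s t => exact s.computes_code.ltCode t.computes_code
  | neg φ ih => exact ih.negCode
  | and φ ψ h₁ h₂ => exact h₁.andCode h₂
  | or φ ψ h₁ h₂ => exact h₁.orCode h₂
  | imp φ ψ h₁ h₂ => exact h₁.impCode h₂
  | iff φ ψ h₁ h₂ => exact h₁.iffCode h₂
  | all n φ ih => exact ih.allCode n
  | ex n φ ih => exact ih.exCode n

end LStar

/-! ### Parsing strings of symbols -/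

namespace LStar

open Function Nat.Partrec Encodable

/-- The entries of the stack of a parser that reads a string from right to left; `bad` marks an
application of a symbol to unsuitable arguments. -/
inductive Entry : Type
  | bad
  | tm (t : Term)
  | fm (φ : Formula)

namespace Entry

/-- The string that the entry stands for. -/
def str : Entry → List Symbol
  | bad => []
  | tm t => t.str
  | fm φ => φ.str

/-- Put a symbol in front of the string whose terms and formulas are on the stack. -/
def push : Symbol → List Entry → List Entry
  | .neg, fm φ :: r => fm (.neg φ) :: r
  | .and, fm φ :: fm ψ :: r => fm (.and φ ψ) :: r
  | .or, fm φ :: fm ψ :: r => fm (.or φ ψ) :: r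
  | .imp, fm φ :: fm ψ :: r => fm (.imp φ ψ) :: r
  | .iff, fm φ :: fm ψ :: r => fm (.iff φ ψ) :: r
  | .all, tm (.var n) :: fm φ :: r => fm (.all n φ) :: r
  | .ex, tm (.var n) :: fm φ :: r => fm (.ex n φ) :: r
  | .eq, tm s :: tm t :: r => fm (.eq s t) :: r
  | .lt, tm s :: tm t :: r => fm (.lt s t) :: r
  | .zero, r => tm .zero :: r
  | .one, r => tm .one :: r
  | .plus, tm s :: tm t :: r => tm (.plus s t) :: r
  | .nu, tm t :: r => tm (.nu t) :: r
  | .var n, r => tm (.var n) :: r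
  | _, r => bad :: r

end Entry

/-- The stack after reading the string: the string is the concatenation of the terms and formulas
on it, unless there is a bad entry. -/
def parse (η : List Symbol) : List Entry := η.foldr Entry.push []

theorem foldr_push_term (t : Term) (r : List Entry) : t.str.foldr Entry.push r = .tm t :: r := by
  induction t generalizing r with
  | var | zero | one => rfl
  | plus s t hs ht => simp [Term.str, hs, ht, Entry.push]
  | nu t ht => simp [Term.str, ht, Entry.push]

theorem foldr_push_formula (φ : Formula) (r : List Entry) :
    φ.str.foldr Entry.push r = .fm φ :: r := by
  induction φ generalizing r with
  | eq s t | lt s t => simp [Formula.str, foldr_push_term, Entry.push]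
  | neg φ ih => simp [Formula.str, ih, Entry.push]
  | and φ ψ h₁ h₂ | or φ ψ h₁ h₂ | imp φ ψ h₁ h₂ | iff φ ψ h₁ h₂ =>
    simp [Formula.str, h₁, h₂, Entry.push]
  | all n φ ih | ex n φ ih => simp [Formula.str, ih, Entry.push]

theorem parse_str (φ : Formula) : parse φ.str = [.fm φ] := foldr_push_formula φ []

theorem str_injective : Injective Formula.str := fun φ ψ h => by
  have := parse_str φ
  rw [h, parse_str ψ] at this
  simpa using this.symm

theorem Entry.flatMap_push (s : Symbol) (st : List Entry) (h : bad ∉ push s st) :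
    bad ∉ st ∧ (push s st).flatMap str = s :: st.flatMap str := by
  unfold push at h ⊢
  split at h <;> simp_all [str, Term.str, Formula.str]

theorem flatMap_parse (η : List Symbol) (h : Entry.bad ∉ parse η) :
    (parse η).flatMap Entry.str = η := by
  induction η with
  | nil => rfl
  | cons s η ih =>
    obtain ⟨h₁, h₂⟩ := Entry.flatMap_push s (parse η) h
    exact h₂.trans (by rw [ih h₁])

/-- The variables of a term, as a list. -/
def Term.varList : Term → List ℕ
  | var n => [n]
  | zero => []
  | one => []
  | plus s t => s.varList ++ t.varList
  | nu t => t.varList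

theorem Term.mem_varList {t : Term} {v : ℕ} : v ∈ t.varList ↔ v ∈ t.vars := by
  induction t with
  | var | zero | one => simp [varList, vars]
  | plus s t hs ht => simp [varList, vars, hs, ht]
  | nu t ht => exact ht

namespace Formula

/-- The free variables of a formula, as a list. -/
def freeVarList : Formula → List ℕ
  | eq s t => s.varList ++ t.varList
  | lt s t => s.varList ++ t.varList
  | neg φ => φ.freeVarList
  | and φ ψ => φ.freeVarList ++ ψ.freeVarList
  | or φ ψ => φ.freeVarList ++ ψ.freeVarList
  | imp φ ψ => φ.freeVarList ++ ψ.freeVarList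
  | iff φ ψ => φ.freeVarList ++ ψ.freeVarList
  | all n φ => φ.freeVarList.filter fun v => ¬ v = n
  | ex n φ => φ.freeVarList.filter fun v => ¬ v = n

theorem mem_freeVarList {φ : Formula} {v : ℕ} : v ∈ φ.freeVarList ↔ v ∈ φ.freeVars := by
  induction φ with
  | eq s t | lt s t => simp [freeVarList, freeVars, Term.mem_varList]
  | neg φ ih => exact ih
  | and φ ψ h₁ h₂ | or φ ψ h₁ h₂ | imp φ ψ h₁ h₂ | iff φ ψ h₁ h₂ =>
    simp [freeVarList, freeVars, h₁, h₂]
  | all n φ ih | ex n φ ih => simp [freeVarList, freeVars, ih, and_comm]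

theorem freeVarList_eq_nil_iff {φ : Formula} : φ.freeVarList = [] ↔ φ.IsSentence := by
  rw [IsSentence, List.eq_nil_iff_forall_not_mem, Finset.eq_empty_iff_forall_notMem]
  simp only [mem_freeVarList]

end Formula

/-! ### Parsing and compiling as a primitive recursive function -/

/-- The data about a stack entry from which the data about compound expressions can be computed:
its kind (`0` for a bad entry, `1` for a formula, `n + 3` for the term `var n`, and `2` for any
other term), its free variables, its weight or level, and its code. -/
abbrev Item : Type := ℕ × List ℕ × ℕ × Code

namespace Item

def kind (i : Item) : ℕ := i.1
def free (i : Item) : List ℕ := i.2.1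
def size (i : Item) : ℕ := i.2.2.1
def code (i : Item) : Code := i.2.2.2

theorem primrec_kind : Primrec kind := .fst
theorem primrec_free : Primrec free := Primrec.fst.comp .snd
theorem primrec_size : Primrec size := Primrec.fst.comp (Primrec.snd.comp .snd)
theorem primrec_code : Primrec code := Primrec.snd.comp (Primrec.snd.comp .snd)

end Item

/-- The kind of a term as in `Item`; it tells variables apart, as quantifiers require them. -/
def Term.kind : Term → ℕ
  | var n => n + 3
  | _ => 2

/-- The data about a stack entry. -/
noncomputable def Entry.item : Entry → Item
  | bad => default
  | tm t => (t.kind, t.varList, t.weight, t.code)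
  | fm φ => (1, φ.freeVarList, φ.level, φ.code)

section

variable (k : ℕ) (x y : Item)

/-- The item of the negation of a formula with the item `x`. -/
noncomputable def negItem : Item :=
  if x.kind = 1 then (1, x.free, x.size, negCode x.code) else default

/-- The item of the formula composed by the binary connective with number `k`. -/
noncomputable def connItem : Item :=
  if x.kind = 1 ∧ y.kind = 1 then (1, x.free ++ y.free, x.size + y.size,
    if k = 1 then andCode x.code y.code else if k = 2 then orCode x.code y.code
    else if k = 3 then impCode x.code y.code else eqCode x.code y.code) else default

/-- The item of the quantified formula with the quantifier with number `k`. -/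
noncomputable def quantItem : Item :=
  if 3 ≤ x.kind ∧ y.kind = 1 then
    (1, y.free.filter fun v => ¬ v = x.kind - 3, nextLevel y.size,
      if k = 5 then allCode (x.kind - 3) y.size y.code else exCode (x.kind - 3) y.size y.code)
  else default

/-- The item of the atomic formula with the relation symbol with number `k`. -/
noncomputable def relItem : Item :=
  if 2 ≤ x.kind ∧ 2 ≤ y.kind then (1, x.free ++ y.free, x.size + y.size + 2,
    if k = 7 then eqCode x.code y.code else ltCode x.code y.code) else default

/-- The item of the sum of two terms. -/
noncomputable def plusItem : Item :=
  if 2 ≤ x.kind ∧ 2 ≤ y.kind then (2, x.free ++ y.free, x.size + y.size,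
    plusCode x.code y.code) else default

/-- The item of `ν` applied to a term. -/
noncomputable def nuItem : Item :=
  if 2 ≤ x.kind then (2, x.free, 33 + 16 * x.size, nuCode x.code) else default

/-- The item of the expression that consists of the symbol with number `k` and arguments with the
items `x` and `y`, as far as it takes arguments. -/
noncomputable def applyItem : Item :=
  if k = 0 then negItem x
  else if k ≤ 4 then connItem k x y
  else if k ≤ 6 then quantItem k x y
  else if k ≤ 8 then relItem k x y
  else if k ≤ 10 then (2, [], 1, Code.const (k - 9))
  else if k = 11 then plusItem x y
  else if k = 12 then nuItem x
  else (k - 13 + 3, [k - 13], 1, varCode (k - 13))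

end

/-- The number of arguments of the symbol with number `k`. -/
def arity (k : ℕ) : ℕ :=
  if k = 0 ∨ k = 12 then 1 else if k ≤ 8 ∨ k = 11 then 2 else 0

/-- The effect of `Entry.push` on the items of the stack. -/
noncomputable def pushItem (s : Symbol) (st : List Item) : List Item :=
  let i := applyItem s.toNat (st.getI 0) (st.getI 1)
  i :: st.drop (if i.kind = 0 then 0 else arity s.toNat)

theorem Term.two_le_kind (t : Term) : 2 ≤ t.kind := by cases t <;> simp [kind]

theorem pushItem_map_item (s : Symbol) (st : List Entry) :
    pushItem s (st.map Entry.item) = (Entry.push s st).map Entry.item := by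
  have h₁ : ∀ t : Term, t.kind ≠ 1 := fun t => by
    have := t.two_le_kind
    omega
  have h₀ : (default : Item).1 = 0 := rfl
  have hvar : ∀ n, (Term.var n).kind = n + 3 := fun _ => rfl
  have hzero : Term.zero.kind = 2 := rfl
  have hone : Term.one.kind = 2 := rfl
  have hplus : ∀ t u : Term, (t.plus u).kind = 2 := fun _ _ => rfl
  have hnu : ∀ t : Term, t.nu.kind = 2 := fun _ => rfl
  cases s with
  | zero | one | var n =>
    simp [pushItem, applyItem, arity, Symbol.toNat, Entry.push, Entry.item, Term.varList,
      Term.weight, Term.code, hzero, hone, hvar]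
  | neg | nu =>
    rcases st with _ | ⟨_ | t | φ, r⟩ <;>
      simp [pushItem, applyItem, negItem, nuItem, arity, Symbol.toNat, Entry.push, Entry.item,
        Item.kind, Item.free, Item.size, Item.code, Term.varList, Term.weight, Term.code,
        Formula.freeVarList, Formula.level, Formula.code, List.getI, h₀, h₁, hnu,
        Term.two_le_kind]
  | all | ex =>
    rcases st with _ | ⟨_ | (n | _ | _ | ⟨t, u⟩ | t) | φ, _ | ⟨_ | u | ψ, r⟩⟩ <;>
      simp [pushItem, applyItem, quantItem, arity, Symbol.toNat, Entry.push, Entry.item,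
        Item.kind, Item.free, Item.size, Item.code, Formula.freeVarList, Formula.level,
        Formula.code, List.getI, h₀, h₁, hvar, hzero, hone, hplus, hnu]
  | eq | lt | plus =>
    rcases st with _ | ⟨_ | t | φ, _ | ⟨_ | u | ψ, r⟩⟩ <;>
      simp [pushItem, applyItem, relItem, plusItem, arity, Symbol.toNat, Entry.push, Entry.item,
        Item.kind, Item.free, Item.size, Item.code, Term.varList, Term.weight, Term.code,
        Formula.freeVarList, Formula.level, Formula.code, List.getI, h₀, hplus, Term.two_le_kind]
  | and | or | imp | iff =>
    rcases st with _ | ⟨_ | t | φ, _ | ⟨_ | u | ψ, r⟩⟩ <;>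
      simp [pushItem, applyItem, connItem, arity, Symbol.toNat, Entry.push, Entry.item,
        Item.kind, Item.free, Item.size, Item.code, Formula.freeVarList, Formula.level,
        Formula.code, List.getI, h₀, h₁]

section

variable {α : Type*} [Primcodable α] {k : α → ℕ} {x y : α → Item}

theorem primrec_le_const (hk : Primrec k) (m : ℕ) : PrimrecPred fun a => k a ≤ m :=
  Primrec.nat_le.comp hk (.const m)

theorem primrec_const_le (hk : Primrec k) (m : ℕ) : PrimrecPred fun a => m ≤ k a :=
  Primrec.nat_le.comp (.const m) hk

theorem primrec_eq_const (hk : Primrec k) (m : ℕ) : PrimrecPred fun a => k a = m :=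
  Primrec.eq.comp hk (.const m)

theorem primrec_item {f : α → List ℕ} {w : α → ℕ} {c : α → Code} (hk : Primrec k)
    (hf : Primrec f) (hw : Primrec w) (hc : Primrec c) :
    Primrec fun a => ((k a, f a, w a, c a) : Item) :=
  hk.pair (hf.pair (hw.pair hc))

theorem primrec_append_free (hx : Primrec x) (hy : Primrec y) :
    Primrec fun a => (x a).free ++ (y a).free :=
  Primrec.list_append.comp (Item.primrec_free.comp hx) (Item.primrec_free.comp hy)

theorem primrec_add_size (hx : Primrec x) (hy : Primrec y) :
    Primrec fun a => (x a).size + (y a).size :=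
  Primrec.nat_add.comp (Item.primrec_size.comp hx) (Item.primrec_size.comp hy)

theorem primrec_negItem (hx : Primrec x) : Primrec fun a => negItem (x a) := by
  unfold negItem
  exact .ite (primrec_eq_const (Item.primrec_kind.comp hx) 1)
    (primrec_item (.const 1) (Item.primrec_free.comp hx) (Item.primrec_size.comp hx)
      (primrec_negCode.comp (Item.primrec_code.comp hx))) (.const _)

theorem primrec_connItem (hk : Primrec k) (hx : Primrec x) (hy : Primrec y) :
    Primrec fun a => connItem (k a) (x a) (y a) := by
  have xc := Item.primrec_code.comp hx
  have yc := Item.primrec_code.comp hy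
  unfold connItem
  refine .ite ((primrec_eq_const (Item.primrec_kind.comp hx) 1).and
    (primrec_eq_const (Item.primrec_kind.comp hy) 1)) (primrec_item (.const 1)
      (primrec_append_free hx hy) (primrec_add_size hx hy) ?_) (.const _)
  exact .ite (primrec_eq_const hk 1) (primrec_andCode.comp xc yc)
    (.ite (primrec_eq_const hk 2) (primrec_orCode.comp xc yc)
      (.ite (primrec_eq_const hk 3) (primrec_impCode.comp xc yc) (primrec_eqCode.comp xc yc)))

theorem primrec_quantItem (hk : Primrec k) (hx : Primrec x) (hy : Primrec y) :
    Primrec fun a => quantItem (k a) (x a) (y a) := by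
  have name := Primrec.nat_sub.comp (Item.primrec_kind.comp hx) (.const 3)
  have args := name.pair ((Item.primrec_size.comp hy).pair (Item.primrec_code.comp hy))
  unfold quantItem
  refine .ite ((primrec_const_le (Item.primrec_kind.comp hx) 3).and
    (primrec_eq_const (Item.primrec_kind.comp hy) 1)) (primrec_item (.const 1) ?_
      (primrec_nextLevel.comp (Item.primrec_size.comp hy)) ?_) (.const _)
  · exact (Primrec.eq (α := ℕ)).not.listFilter.comp (Item.primrec_free.comp hy) name
  · exact .ite (primrec_eq_const hk 5) (primrec_allCode.comp args) (primrec_exCode.comp args)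

theorem primrec_relItem (hk : Primrec k) (hx : Primrec x) (hy : Primrec y) :
    Primrec fun a => relItem (k a) (x a) (y a) := by
  have xc := Item.primrec_code.comp hx
  have yc := Item.primrec_code.comp hy
  unfold relItem
  exact .ite ((primrec_const_le (Item.primrec_kind.comp hx) 2).and
    (primrec_const_le (Item.primrec_kind.comp hy) 2)) (primrec_item (.const 1)
      (primrec_append_free hx hy) (Primrec.nat_add.comp (primrec_add_size hx hy) (.const 2))
      (.ite (primrec_eq_const hk 7) (primrec_eqCode.comp xc yc) (primrec_ltCode.comp xc yc)))
    (.const _)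

theorem primrec_plusItem (hx : Primrec x) (hy : Primrec y) :
    Primrec fun a => plusItem (x a) (y a) := by
  unfold plusItem
  exact .ite ((primrec_const_le (Item.primrec_kind.comp hx) 2).and
    (primrec_const_le (Item.primrec_kind.comp hy) 2)) (primrec_item (.const 2)
      (primrec_append_free hx hy) (primrec_add_size hx hy)
      (primrec_plusCode.comp (Item.primrec_code.comp hx) (Item.primrec_code.comp hy))) (.const _)

theorem primrec_nuItem (hx : Primrec x) : Primrec fun a => nuItem (x a) := by
  unfold nuItem
  exact .ite (primrec_const_le (Item.primrec_kind.comp hx) 2)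
    (primrec_item (.const 2) (Item.primrec_free.comp hx) (Primrec.nat_add.comp (.const 33)
      (Primrec.nat_mul.comp (.const 16) (Item.primrec_size.comp hx)))
      (primrec_nuCode.comp (Item.primrec_code.comp hx))) (.const _)

theorem primrec_applyItem (hk : Primrec k) (hx : Primrec x) (hy : Primrec y) :
    Primrec fun a => applyItem (k a) (x a) (y a) := by
  have index := Primrec.nat_sub.comp hk (.const 13)
  unfold applyItem
  refine .ite (primrec_eq_const hk 0) (primrec_negItem hx)
    (.ite (primrec_le_const hk 4) (primrec_connItem hk hx hy)
    (.ite (primrec_le_const hk 6) (primrec_quantItem hk hx hy)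
    (.ite (primrec_le_const hk 8) (primrec_relItem hk hx hy)
    (.ite (primrec_le_const hk 10) (primrec_item (.const 2) (.const []) (.const 1) ?_)
    (.ite (primrec_eq_const hk 11) (primrec_plusItem hx hy)
    (.ite (primrec_eq_const hk 12) (primrec_nuItem hx)
    (primrec_item ?_ ?_ (.const 1) ?_)))))))
  · exact Code.primrec_const.comp (Primrec.nat_sub.comp hk (.const 9))
  · exact Primrec.nat_add.comp index (.const 3)
  · exact Primrec.list_cons.comp index (.const [])
  · exact primrec_varCode.comp index

end

theorem primrec_arity : Primrec arity := by
  have eq : ∀ m, PrimrecPred fun k : ℕ => k = m := fun m => Primrec.eq.comp .id (.const m)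
  exact .ite ((eq 0).or (eq 12)) (.const 1)
    (.ite ((Primrec.nat_le.comp .id (.const 8)).or (eq 11)) (.const 2) (.const 0))

theorem primrec_toNat : Primrec Symbol.toNat := Primrec.of_equiv (e := Symbol.equivNat)

theorem primrec_pushItem : Primrec₂ pushItem := by
  have k : Primrec fun p : Symbol × List Item => p.1.toNat := primrec_toNat.comp .fst
  have i := primrec_applyItem k (Primrec.list_getI.comp Primrec.snd (.const 0))
    (Primrec.list_getI.comp Primrec.snd (.const 1))
  exact Primrec.list_cons.comp i (Primrec.list_drop.comp
    (.ite (Primrec.eq.comp (Item.primrec_kind.comp i) (.const 0)) (.const 0)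
      (primrec_arity.comp k)) .snd)

/-- The items of the parse of a string. -/
noncomputable def items (η : List Symbol) : List Item := η.foldr pushItem []

theorem primrec_items : Primrec items :=
  Primrec.list_foldr .id (.const []) (primrec_pushItem.comp (Primrec.fst.comp .snd)
    (Primrec.snd.comp .snd)).to₂

theorem items_eq_map_parse (η : List Symbol) : items η = (parse η).map Entry.item := by
  induction η with
  | nil => rfl
  | cons s η ih => exact (congrArg _ ih).trans (pushItem_map_item s (parse η))

end LStar

/-! ### Decidability of truth in `M*` -/

namespace LStar

open Function Nat.Partrec Encodable

theorem Entry.exists_eval_item_code (x : Entry) :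
    ∃ v, x.item.code.eval (encode ([] : List (ℕ × ℕ))) = Part.some v := by
  cases x with
  | bad => exact ⟨0, rfl⟩
  | tm t => exact ⟨_, t.computes_code []⟩
  | fm φ => exact ⟨_, φ.decides_code []⟩

/-- The strings that are true sentences can be recognized from the items of their parse: there is
a single item, it is the item of a formula without free variables, and its code gives `1`. -/
theorem exists_mem_TStar_iff {η : List Symbol} {v : ℕ}
    (hv : ((items η).getI 0).code.eval (encode ([] : List (ℕ × ℕ))) = Part.some v) :
    (∃ σ ∈ TStar, σ.str = η) ↔
      (items η).map (fun i => (i.kind, i.free)) = [(1, [])] ∧ v = 1 := by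
  classical
  constructor
  · rintro ⟨σ, hσ, rfl⟩
    rw [items_eq_map_parse, parse_str] at hv ⊢
    have h := (σ.decides_code []).symm.trans hv
    rw [Part.some_inj] at h
    dsimp only at h
    rw [if_pos (hσ.2 _)] at h
    exact ⟨by simp [Entry.item, Item.kind, Item.free, Formula.freeVarList_eq_nil_iff.2 hσ.1],
      h.symm⟩
  · rintro ⟨hη, rfl⟩
    rw [items_eq_map_parse] at hη hv
    obtain ⟨x, hx⟩ : ∃ x, parse η = [x] := by
      rw [← List.length_eq_one_iff]
      simpa using congrArg List.length hη
    have hstr := flatMap_parse η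
    rw [hx] at hη hv hstr
    match x, hη, hv, hstr with
    | .bad, hη, _, _ =>
      simp [Entry.item, Item.kind, show (default : Item).1 = 0 from rfl] at hη
    | .tm t, hη, _, _ =>
      have := t.two_le_kind
      simp [Entry.item, Item.kind] at hη
      omega
    | .fm φ, hη, hv, hstr =>
      have hs : φ.IsSentence := by
        rw [← Formula.freeVarList_eq_nil_iff]
        simpa [Entry.item, Item.kind, Item.free] using hη
      have h := (φ.decides_code []).symm.trans hv
      rw [Part.some_inj] at h
      dsimp only at h
      refine ⟨φ, (mem_TStar_iff hs (env [])).2 (of_not_not fun hn => ?_), by simpa [Entry.str] using hstr⟩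
      rw [if_neg hn] at h
      exact zero_ne_one h

theorem computablePred_exists_mem_TStar :
    ComputablePred fun η : List Symbol => ∃ σ ∈ TStar, σ.str = η := by
  have htot : ∀ η, ∃ v, ((items η).getI 0).code.eval (encode ([] : List (ℕ × ℕ))) =
      Part.some v := fun η => by
    rw [items_eq_map_parse]
    cases parse η with
    | nil => exact ⟨0, rfl⟩
    | cons x r => exact x.exists_eval_item_code
  choose v hv using htot
  have hvc : Computable v :=
    Partrec.of_eq_tot (Code.eval_part.comp
      (Item.primrec_code.comp (Primrec.list_getI.comp primrec_items (.const 0))).to_comp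
      (Computable.const _)) fun η => by rw [hv η]; exact Part.mem_some _
  have hitems : Primrec fun η => (items η).map fun i => (i.kind, i.free) :=
    Primrec.list_map primrec_items
      ((Item.primrec_kind.comp .snd).pair (Item.primrec_free.comp .snd)).to₂
  have h₁ : Computable fun η => decide ((items η).map (fun i => (i.kind, i.free)) = [(1, [])]) :=
    (Primrec.eq.decide.comp hitems (.const _)).to_comp
  have h₂ : Computable fun η => decide (v η = 1) :=
    Primrec.eq.decide.to_comp.comp hvc (.const 1)
  refine ⟨Classical.decPred _, (Primrec.and.to_comp.comp h₁ h₂).of_eq fun η => ?_⟩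
  rw [← Bool.decide_and]
  exact decide_eq_decide.2 (exists_mem_TStar_iff (hv η)).symm

theorem decidableTheory_TStar : DecidableTheory TStar := by
  refine computablePred_exists_mem_TStar.of_eq fun η => exists_congr fun σ => ?_
  constructor
  · rintro ⟨h, hη⟩
    exact ⟨h.1, provable_of_mem h, hη⟩
  · rintro ⟨hs, hp, hη⟩
    exact ⟨(provable_TStar_iff hs).1 hp, hη⟩

/-! ### The new coding -/

/-- Ackermann's code by recursion, except that the empty string has code `0`. -/
def ackermannAux (symCode : Symbol → ℕ) (η : List Symbol) : ℕ :=
  η.foldr (fun s r => 2 ^ (symCode s + 1) * (1 + r)) 0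

section

variable {symCode : Symbol → ℕ}

theorem ackermannAux_cons (s : Symbol) (η : List Symbol) :
    ackermannAux symCode (s :: η) = 2 ^ (symCode s + 1) * (1 + ackermannAux symCode η) := rfl

theorem ackermannAux_eq_sum (η : List Symbol) :
    ackermannAux symCode η = ∑ k ∈ Finset.range η.length,
      2 ^ (((η.take (k + 1)).map fun s => symCode s + 1).sum) := by
  induction η with
  | nil => rfl
  | cons s η ih =>
    rw [List.length_cons, Finset.sum_range_succ', ackermannAux_cons, ih, mul_add,
      Finset.mul_sum, add_comm]
    simp [pow_add]

theorem ackermann_eq (η : List Symbol) :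
    ackermann symCode η = if η = [] then 1 else ackermannAux symCode η := by
  cases η with
  | nil => rfl
  | cons s η => rw [if_neg (by simp), ackermannAux_eq_sum]; rfl

theorem even_ackermannAux (η : List Symbol) : Even (ackermannAux symCode η) := by
  cases η with
  | nil => exact Even.zero
  | cons s η =>
    rw [ackermannAux_cons, pow_succ, mul_right_comm]
    exact even_two.mul_left _

/-- The code of the first symbol is determined by the power of two that divides the code of the
string. -/
theorem ackermannAux_injective (hinj : Injective symCode) : Injective (ackermannAux symCode) := by
  intro η
  induction η with
  | nil =>
    intro θ h
    cases θ with
    | nil => rfl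
    | cons t θ => simp [ackermannAux] at h
  | cons s η ih =>
    intro θ h
    cases θ with
    | nil => simp [ackermannAux] at h
    | cons t θ =>
      rw [ackermannAux_cons, ackermannAux_cons] at h
      have odd : ∀ ζ, ¬ 2 ∣ 1 + ackermannAux symCode ζ := fun ζ => by
        have := even_ackermannAux (symCode := symCode) ζ
        rw [even_iff_two_dvd] at this
        omega
      have val : ∀ a ζ, padicValNat 2 (2 ^ a * (1 + ackermannAux symCode ζ)) = a := fun a ζ => by
        rw [padicValNat.mul (by positivity) (by omega), padicValNat.prime_pow,
          padicValNat.eq_zero_of_not_dvd (odd ζ), add_zero]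
      have hs : symCode s + 1 = symCode t + 1 := by
        rw [← val (symCode s + 1) η, h, val]
      rw [hs] at h
      have := Nat.eq_of_mul_eq_mul_left (by positivity) h
      rw [hinj (Nat.succ_injective hs), ih (Nat.add_left_cancel this)]

theorem ackermann_injective (hinj : Injective symCode) : Injective (ackermann symCode) := by
  intro η θ h
  rw [ackermann_eq, ackermann_eq] at h
  have hη := even_ackermannAux (symCode := symCode) η
  have hθ := even_ackermannAux (symCode := symCode) θ
  rw [Nat.even_iff] at hη hθ
  split_ifs at h with h₁ h₂ h₂
  · rw [h₁, h₂]
  · omega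
  · omega
  · exact ackermannAux_injective hinj h

theorem ackermann_cons_neg (hneg : symCode .neg = 3) {η : List Symbol} (hη : η ≠ []) :
    ackermann symCode (.neg :: η) = 16 + 16 * ackermann symCode η := by
  rw [ackermann_eq, ackermann_eq, if_neg (by simp), if_neg hη, ackermannAux_cons,
    hneg]
  ring

theorem computable_list_foldr {α σ : Type*} [Primcodable α] [Primcodable σ] {f : α → σ → σ}
    (hf : Computable₂ f) (b : σ) : Computable fun l : List α => l.foldr f b := by
  -- the state after `i` steps is the fold of the last `i` entries
  have h : Computable fun l : List α =>
      (Nat.rec b (fun i r => (l.reverse[i]?.map fun a => f a r).getD r) l.length : σ) := by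
    refine Computable.nat_rec (h := fun l (p : ℕ × σ) =>
      (l.reverse[p.1]?.map fun a => f a p.2).getD p.2) Computable.list_length (.const b) ?_
    refine Computable.option_getD (Computable.option_map ?_ ?_) (Computable.snd.comp .snd)
    · exact Computable.list_getElem?.comp (Computable.list_reverse.comp .fst)
        (Computable.fst.comp .snd)
    · exact hf.comp .snd (Computable.snd.comp (Computable.snd.comp .fst))
  refine h.of_eq fun l => ?_
  have key : ∀ m : List α, (Nat.rec b (fun i r => (m[i]?.map fun a => f a r).getD r) m.length : σ)
      = m.foldl (fun r a => f a r) b := by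
    intro m
    have : ∀ i ≤ m.length, (Nat.rec b (fun i r => (m[i]?.map fun a => f a r).getD r) i : σ) =
        (m.take i).foldl (fun r a => f a r) b := by
      intro i
      induction i with
      | zero => simp
      | succ i ih =>
        intro hi
        have hget : m[i]? = some m[i] := List.getElem?_eq_getElem _
        rw [List.take_add_one, List.foldl_append, ← ih (by omega)]
        change (m[i]?.map fun a => f a _).getD _ = _
        rw [hget]
        rfl
    simpa using this m.length le_rfl
  rw [← List.length_reverse, key, List.foldl_reverse]

theorem computable_ackermann (hcomp : Computable symCode) : Computable (ackermann symCode) := by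
  have pow : Primrec fun n : ℕ => 2 ^ n := by
    refine (Primrec.nat_rec₁ (f := fun _ r => 2 * r) 1
      (Primrec.nat_mul.comp (.const 2) .snd)).of_eq fun n => ?_
    induction n with
    | zero => rfl
    | succ n ih => rw [pow_succ', ← ih]
  have aux : Computable (ackermannAux symCode) := by
    refine computable_list_foldr (f := fun s r => 2 ^ (symCode s + 1) * (1 + r)) ?_ 0
    exact Primrec.nat_mul.to_comp.comp
      (pow.to_comp.comp (Computable.succ.comp (hcomp.comp .fst)))
      (Primrec.nat_add.to_comp.comp (.const 1) .snd)
  have nil : Computable fun η : List Symbol => decide (η.length = 0) :=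
    Primrec.eq.decide.to_comp.comp Computable.list_length (.const 0)
  refine (Computable.cond nil (.const 1) aux).of_eq fun η => ?_
  rw [ackermann_eq]
  cases η <;> simp

open Classical in
theorem newCode_str (σ : Formula) : newCode symCode σ.str =
    if σ ∈ TStar then 2 * ackermann symCode σ.str else 1 + 2 * ackermann symCode σ.str := by
  have : (∃ τ ∈ TStar, τ.str = σ.str) ↔ σ ∈ TStar :=
    ⟨fun ⟨τ, hτ, h⟩ => str_injective h ▸ hτ, fun h => ⟨σ, h, rfl⟩⟩
  simp only [newCode, this]

theorem even_newCode_str (σ : Formula) : Even (newCode symCode σ.str) ↔ σ ∈ TStar := by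
  rw [newCode_str, Nat.even_iff]
  split_ifs with h <;> simp only [h, iff_true, iff_false] <;> omega

theorem isGodelCoding_newCode (hcomp : Computable symCode) (hinj : Injective symCode) :
    IsGodelCoding (newCode symCode) := by
  constructor
  · obtain ⟨_, hdec⟩ := computablePred_exists_mem_TStar
    have hdouble : Computable fun η => 2 * ackermann symCode η :=
      Primrec.nat_double.to_comp.comp (computable_ackermann hcomp)
    refine (Computable.cond hdec hdouble
      (Primrec.nat_add.to_comp.comp (.const 1) hdouble)).of_eq fun η => ?_
    by_cases h : ∃ σ ∈ TStar, σ.str = η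
    · rw [newCode, if_pos h, decide_eq_true h, cond_true]
    · rw [newCode, if_neg h, decide_eq_false h, cond_false]
  · intro η θ h
    refine ackermann_injective hinj ?_
    unfold newCode at h
    split_ifs at h <;> omega

/-- `ν*` maps the code of a sentence to the code of its negation: exactly one of them is true,
so the parity of the code changes. -/
theorem nuStar_newCode (hneg : symCode .neg = 3) {σ : Formula} (hσ : σ.IsSentence) :
    nuStar (newCode symCode σ.str) = newCode symCode (Formula.neg σ).str := by
  have hne : σ.str ≠ [] := by cases σ <;> simp [Formula.str]
  have hnot : σ.neg ∈ TStar ↔ σ ∉ TStar := by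
    rw [mem_TStar_iff hσ 0, mem_TStar_iff (σ := .neg σ) hσ 0]
    rfl
  have hack : ackermann symCode σ.neg.str = 16 + 16 * ackermann symCode σ.str :=
    ackermann_cons_neg hneg hne
  by_cases h : σ ∈ TStar
  · rw [nuStar, if_pos ((even_newCode_str σ).2 h), newCode_str, if_pos h, newCode_str,
      if_neg fun hn => hnot.1 hn h, hack]
    ring
  · rw [nuStar, if_neg (mt (even_newCode_str σ).1 h), newCode_str, if_neg h, newCode_str,
      if_pos (hnot.2 h), hack]
    ring

end

/-! ### The theory `Q⁻` and the four statements -/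

theorem QMinus_subset_TStar {symCode : Symbol → ℕ} (hneg : symCode .neg = 3) :
    QMinus (newCode symCode) ⊆ TStar := by
  intro φ hφ
  cases hφ with
  | A₁ n =>
    refine ⟨by simp [Formula.IsSentence, Formula.freeVars, Term.vars], fun e a => ?_⟩
    simp only [Formula.Sat, Term.eval_num, Term.eval, update_self]
    exact lt_trichotomy a n
  | A₂ n =>
    have hfree : (Formula.disj ((List.range n).map fun i => .eq (.var 0) (Term.num i))).freeVars ⊆
        {0} := fun v hv => by
      obtain ⟨ψ, hψ, hv⟩ := Formula.freeVars_disj _ v hv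
      obtain ⟨i, -, rfl⟩ := List.mem_map.1 hψ
      simpa [Formula.freeVars, Term.vars] using hv
    refine ⟨?_, fun e a => ?_⟩
    · rw [Formula.IsSentence, Formula.freeVars, Finset.erase_eq_empty_iff]
      rw [← Finset.subset_singleton_iff, Formula.freeVars]
      exact Finset.union_subset (by simp [Formula.freeVars, Term.vars]) hfree
    · simp [Formula.Sat, Formula.sat_disj, Term.eval]
  | A₃ σ hσ =>
    refine ⟨by simp [Formula.IsSentence, Formula.freeVars, Term.vars, quote], fun e => ?_⟩
    simp only [Formula.Sat, Term.eval, quote, Term.eval_num]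
    exact nuStar_newCode hneg hσ

theorem sat_evenFormula {v : ℕ} (hv : v ≠ 2) (e : ℕ → ℕ) : (evenFormula v).Sat e ↔ Even (e v) := by
  simp [evenFormula, Formula.Sat, Term.eval, Even, hv]

theorem freeVars_evenFormula {v : ℕ} (hv : v ≠ 2) : (evenFormula v).freeVars = {v} := by
  ext i
  simp only [evenFormula, Formula.freeVars, Term.vars, Finset.mem_erase, Finset.mem_union,
    Finset.mem_singleton]
  omega

section

variable {code : List Symbol → ℕ}

theorem sat_subst_num (φ : Formula) (x n : ℕ) (e : ℕ → ℕ) :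
    (φ.subst x (Term.num n)).Sat e ↔ φ.Sat (update e x n) := by
  rw [Formula.sat_subst (Formula.freeFor_of_vars_eq_empty (Term.vars_num n) x φ), Term.eval_num]

theorem sat_PsiStar_subst (n : ℕ) (e : ℕ → ℕ) : (PsiStar.subst 0 (Term.num n)).Sat e ↔ Even n := by
  rw [sat_subst_num, PsiStar, sat_evenFormula (by decide), update_self]

theorem isSentence_PsiStar_subst (n : ℕ) : (PsiStar.subst 0 (Term.num n)).IsSentence := by
  simp [PsiStar, evenFormula, Formula.subst, Term.subst, Formula.IsSentence, Formula.freeVars,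
    Term.vars]

theorem sat_ThetaStar_subst (m n : ℕ) (e : ℕ → ℕ) :
    ((ThetaStar.subst 0 (Term.num m)).subst 1 (Term.num n)).Sat e ↔ Even n := by
  rw [sat_subst_num, sat_subst_num, ThetaStar]
  simp [Formula.Sat, sat_evenFormula]

theorem isSentence_ThetaStar_subst (m n : ℕ) :
    ((ThetaStar.subst 0 (Term.num m)).subst 1 (Term.num n)).IsSentence := by
  have h : ∀ x : ℕ, ∀ t : Term, ∀ k, (Term.num k).subst x t = Term.num k := fun x t k =>
    Term.subst_of_notMem (by simp)
  simp [ThetaStar, evenFormula, Formula.subst, Term.subst, Formula.IsSentence, Formula.freeVars,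
    Term.vars, h]

/-- If the codes of the true sentences are the even codes of sentences, then evenness is a
provability predicate of `T*`. -/
theorem not_godelFor (heven : ∀ σ : Formula, Even (code σ.str) ↔ σ ∈ TStar) :
    ¬ GodelFor code TStar TStar 0 PsiStar := fun h =>
  h isTheory_TStar (fun _ _ => id) consistent_TStar (freeVars_evenFormula (by decide))
    (fun σ hσ => by
      rw [provable_TStar_iff hσ, quote, provable_TStar_iff (isSentence_PsiStar_subst _),
        mem_TStar_iff (isSentence_PsiStar_subst _) 0, sat_PsiStar_subst, heven])
    complete_TStar

theorem not_tarskiFor (heven : ∀ σ : Formula, Even (code σ.str) ↔ σ ∈ TStar) :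
    ¬ TarskiFor code TStar 0 UpsilonStar := fun h =>
  h (freeVars_evenFormula (by decide)) (consistent_of_sat 0 (by
    rintro φ (hφ | ⟨σ, hσ, rfl⟩)
    · exact hφ.2 0
    · exact (sat_PsiStar_subst _ 0).trans ((heven σ).trans (mem_TStar_iff hσ 0))))

theorem not_carnapFor (heven : ∀ σ : Formula, Even (code σ.str) ↔ σ ∈ TStar) :
    ¬ CarnapFor code TStar 0 LambdaStar := fun h => by
  obtain ⟨A, hA, hp⟩ := h (freeVars_evenFormula (by decide))
  obtain ⟨φ, hφ, hs⟩ := (Formula.sat_disj 0 _).1 (hp.sat 0 fun γ hγ => hγ.2 0)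
  obtain ⟨σ, hσ, rfl⟩ := List.mem_map.1 hφ
  have : ¬ (PsiStar.subst 0 (quote code σ)).Sat 0 ↔ σ.Sat 0 := hs
  rw [quote, sat_PsiStar_subst, heven, mem_TStar_iff (hA σ hσ) 0] at this
  exact iff_not_self this.symm

theorem not_rosserFor (heven : ∀ σ : Formula, Even (code σ.str) ↔ σ ∈ TStar) :
    ¬ RosserFor code TStar TStar 0 1 ThetaStar := fun h => by
  refine h isTheory_TStar (fun _ _ => id) consistent_TStar zero_ne_one ?_ (fun σ hσ => ?_)
    complete_TStar
  · rw [ThetaStar, Formula.freeVars, freeVars_evenFormula (by decide)]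
    decide
  · rw [provable_TStar_iff hσ, ← heven]
    refine ⟨fun he => ⟨0, provable_of_mem ?_⟩, fun he n => provable_of_mem ?_⟩
    · exact (mem_TStar_iff (isSentence_ThetaStar_subst _ _) 0).2 ((sat_ThetaStar_subst _ _ _).2 he)
    · exact ⟨isSentence_ThetaStar_subst _ _, fun e => mt (sat_ThetaStar_subst _ _ _).1 he⟩

end

end LStar

theorem theorem2p7 (symCode : LStar.Symbol → ℕ) (hcomp : Computable symCode)
    (hinj : Function.Injective symCode) (hodd : ∀ s, Odd (symCode s))
    (hneg : symCode LStar.Symbol.neg = 3) :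
    -- the new coding is a Gödel coding
    LStar.IsGodelCoding (LStar.newCode symCode) ∧
    -- `T*` is a complete, decidable theory containing `Q⁻`
    LStar.IsTheory LStar.TStar ∧
    LStar.Complete LStar.TStar ∧
    LStar.DecidableTheory LStar.TStar ∧
    LStar.QMinus (LStar.newCode symCode) ⊆ LStar.TStar ∧
    -- the four statements fail for `U = T*` and the explicit formulas
    ¬ LStar.GodelFor (LStar.newCode symCode) LStar.TStar LStar.TStar 0 LStar.PsiStar ∧
    ¬ LStar.TarskiFor (LStar.newCode symCode) LStar.TStar 0 LStar.UpsilonStar ∧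
    ¬ LStar.CarnapFor (LStar.newCode symCode) LStar.TStar 0 LStar.LambdaStar ∧
    ¬ LStar.RosserFor (LStar.newCode symCode) LStar.TStar LStar.TStar 0 1 LStar.ThetaStar ∧
    -- hence they fail in general
    ¬ LStar.Godel (LStar.newCode symCode) LStar.TStar ∧
    ¬ LStar.Tarski (LStar.newCode symCode) LStar.TStar ∧
    ¬ LStar.Carnap (LStar.newCode symCode) LStar.TStar ∧
    ¬ LStar.Rosser (LStar.newCode symCode) LStar.TStar := by

  have heven : ∀ σ : LStar.Formula, Even (LStar.newCode symCode σ.str) ↔ σ ∈ LStar.TStar :=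
    LStar.even_newCode_str
  have hG := LStar.not_godelFor heven
  have hT := LStar.not_tarskiFor heven
  have hC := LStar.not_carnapFor heven
  have hR := LStar.not_rosserFor heven
  exact ⟨LStar.isGodelCoding_newCode hcomp hinj, LStar.isTheory_TStar, LStar.complete_TStar,
    LStar.decidableTheory_TStar, LStar.QMinus_subset_TStar hneg, hG, hT, hC, hR,
    fun h => hG (h _ _ _), fun h => hT (h _ _), fun h => hC (h _ _), fun h => hR (h _ _ _ _)⟩
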